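/- Let $\mathscr V$ be a braided monoidal additive category: a braided monoidal category with unit $I$ and braiding $c$, whose hom sets are abelian groups such that composition and $\otimes$ are bi-additive. Assume that $\mathscr V$ has finite direct sums, that idempotents split in $\mathscr V$, and that multiplication by $2$ is invertible on every hom group $\mathscr V(X,Y)$. A symmetric self-duality on an object $A$ is a morphism $\bullet : A\otimes A\to I$ with $\bullet\circ c_{A,A}=\bullet$ such that, for all $X,Y$, the function $\mathscr V(X,Y\otimes A)\to\mathscr V(X\otimes A,Y)$, $f\mapsto (1_Y\otimes\bullet)(f\otimes 1_A)$, is a bijection. (Associativity and unit isomorphisms are suppressed.) A vector product algebra is an object $V$ with a symmetric self-duality $\bullet$ and a morphism $\wedge : V\otimes V\to V$ such that - $\wedge=-\wedge\circ c_{V,V}$; - $\bullet(\wedge\otimes 1)=\bullet(\wedge\otimes 1)\,c_{V\otimes V,V}$; - $\wedge(\wedge\otimes 1)+\wedge(1\otimes\wedge)=2\,(1\otimes\bullet)(c_{V,V}\otimes 1)-(\bullet\otimes 1)-(1\otimes\bullet)$ as morphisms $V\otimes V\otimes V\to V$. Morphisms of vector product algebras preserve $\bullet$ and $\wedge$; the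 category is $\mathbf{VPA}$. A composition algebra is an object $A$ with a symmetric self-duality $\bullet$ and morphisms $m:A\otimes A\to A$ and $e:I\to A$ such that - $\bullet(e\otimes e)=1_I$; - $m\,c_{A,A}\,c_{A,A}=m$; - $m(e\otimes 1)=1_A=m(1\otimes e)$; - $\bullet(m\otimes m)(1\otimes c_{A,A}\otimes 1)+\bullet(m\otimes m)(1\otimes c_{A\otimes A,A})=2\,(\bullet\otimes\bullet)$ as morphisms $A^{\otimes 4}\to I$. Morphisms of composition algebras preserve $\bullet$, $m$ and $e$; the category is $\mathbf{CA}$. For a composition algebra $A$ put $p=\bullet(1_A\otimes e):A\to I$ and $\wedge_A=\tfrac12(m-m\,c_{A,A})$. **Theorem.** Every composition algebra $A$ admits a splitting $A\xrightarrow{q}V\xrightarrow{i}A$, $qi=1_V$, $iq=1_A-ep$. For every choice, for each $A$, of such a splitting, the object $V$ with $\bullet(i\otimes i)$ and $q\wedge_A(i\otimes i)$ is a vector product algebra, and the functor $\Phi:\mathbf{CA}\to\mathbf{VPA}$ sending $A$ to this $V$ and $f:A\to B$ to its restriction $q_Bfi_A$ is an equivalence of categories. A quasi-inverse $\Psi:\mathbf{VPA}\to\mathbf{CA}$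 (that is, $\Psi\Phi\cong 1$ and $\Phi\Psi\cong 1$) sends a vector product algebra $V$ to the direct sum $A=I\oplus V$, with projections $p,q$ and inclusions $e,i$. This $A$ is a composition algebra with inner product $\bullet(q\otimes q)+p\otimes p$, identity $e$, and the multiplication $$m=e\,\bigl(p\otimes p-\bullet(q\otimes q)\bigr)+i\,\bigl(p\otimes q+q\otimes p+\wedge(q\otimes q)\bigr).$$ On morphisms $\Psi(g)=1_I\oplus g$. -/

import Mathlib

open CategoryTheory MonoidalCategory Limits

universe v u

attribute [local instance] Limits.hasBinaryBiproducts_of_finite_biproducts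

namespace BraidedAlg

section Axioms

variable {C : Type u} [Category.{v} C] [MonoidalCategory C]

/-- A morphism `ε : A ⊗ B ⟶ I` is a counit for a duality `A ⊣ B` when, for all `X` and `Y`, the
function sending `f : X ⟶ Y ⊗ A` to `X ⊗ B ⟶ (Y ⊗ A) ⊗ B ≅ Y ⊗ (A ⊗ B) ⟶ Y ⊗ I ≅ Y` is a
bijection. -/
def IsDualityCounit {A B : C} (ε : A ⊗ B ⟶ 𝟙_ C) : Prop :=
  ∀ X Y : C, Function.Bijective
    (fun f : X ⟶ Y ⊗ A => (f ▷ B ≫ (α_ Y A B).hom ≫ Y ◁ ε ≫ (ρ_ Y).hom : X ⊗ B ⟶ Y))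

/-- Multiplication by `2` is invertible on every hom group. -/
def TwoInvertible (C : Type u) [Category.{v} C] [Preadditive C] : Prop :=
  ∀ X Y : C, Function.Bijective (fun f : X ⟶ Y => (2 : ℤ) • f)

variable [BraidedCategory C]

/-- `cup` is the counit of a symmetric self-duality. -/
structure IsSymmetricSelfDuality {A : C} (cup : A ⊗ A ⟶ 𝟙_ C) : Prop where
  counit : IsDualityCounit cup
  symm : (β_ A A).hom ≫ cup = cup

variable [Preadditive C]

/-- The axioms of a vector product algebra with inner product `cup` (written `x · y` below) and
vector product `wedge` (written `x ∧ y` below). -/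
structure IsVectorProductAlgebra {V : C} (cup : V ⊗ V ⟶ 𝟙_ C) (wedge : V ⊗ V ⟶ V) : Prop where
  selfDual : IsSymmetricSelfDuality cup
  /-- `x ∧ y = - y ∧ x` -/
  asymm : wedge = -((β_ V V).hom ≫ wedge)
  /-- `(x ∧ y) · z = (z ∧ x) · y` -/
  cyclic : wedge ▷ V ≫ cup =
    (β_ (V ⊗ V) V).hom ≫ (α_ V V V).inv ≫ wedge ▷ V ≫ cup
  /-- `(x ∧ y) ∧ z + x ∧ (y ∧ z) = 2 (x · z) y - (x · y) z - (y · z) x` -/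
  wedge_wedge : wedge ▷ V ≫ wedge + (α_ V V V).hom ≫ V ◁ wedge ≫ wedge =
    (2 : ℤ) • ((β_ V V).hom ▷ V ≫ (α_ V V V).hom ≫ V ◁ cup ≫ (ρ_ V).hom)
      - cup ▷ V ≫ (λ_ V).hom - (α_ V V V).hom ≫ V ◁ cup ≫ (ρ_ V).hom

/-- The axioms of a composition algebra with inner product `cup` (written `x · y` below),
multiplication `mul` and identity `one`. -/
structure IsCompositionAlgebra {A : C} (cup : A ⊗ A ⟶ 𝟙_ C) (mul : A ⊗ A ⟶ A)
    (one : 𝟙_ C ⟶ A) : Prop where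
  selfDual : IsSymmetricSelfDuality cup
  /-- `e · e = 1` -/
  one_cup_one : (λ_ (𝟙_ C)).inv ≫ (one ⊗ₘ one) ≫ cup = 𝟙 (𝟙_ C)
  /-- the multiplication does not distinguish the braiding from its inverse -/
  braid_braid_mul : (β_ A A).hom ≫ (β_ A A).hom ≫ mul = mul
  one_mul : one ▷ A ≫ mul = (λ_ A).hom
  mul_one : A ◁ one ≫ mul = (ρ_ A).hom
  /-- `(x z) · (y w) + (x w) · (y z) = 2 (x · y) (z · w)`, where the arguments are read in the
  order `x, y, z, w` and strings moving to the right pass over those moving to the left -/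
  composition : tensorμ A A A A ≫ (mul ⊗ₘ mul) ≫ cup
      + (α_ A A (A ⊗ A)).hom ≫ A ◁ ((α_ A A A).inv ≫ (β_ (A ⊗ A) A).hom) ≫
          (α_ A A (A ⊗ A)).inv ≫ (mul ⊗ₘ mul) ≫ cup =
    (2 : ℤ) • ((cup ⊗ₘ cup) ≫ (λ_ (𝟙_ C)).hom)

end Axioms

/-- The half of a morphism. -/
noncomputable def half {C : Type u} [Category.{v} C] [Preadditive C] (h2 : TwoInvertible C)
    {X Y : C} (f : X ⟶ Y) : X ⟶ Y :=
  Classical.choose ((h2 X Y).2 f)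

theorem two_half {C : Type u} [Category.{v} C] [Preadditive C] (h2 : TwoInvertible C)
    {X Y : C} (f : X ⟶ Y) : (2 : ℤ) • half h2 f = f :=
  Classical.choose_spec ((h2 X Y).2 f)

/-- A vector product algebra in `C`. -/
structure VPA (C : Type u) [Category.{v} C] [MonoidalCategory C] [BraidedCategory C]
    [Preadditive C] where
  X : C
  cup : X ⊗ X ⟶ 𝟙_ C
  wedge : X ⊗ X ⟶ X
  isVPA : IsVectorProductAlgebra cup wedge

/-- A composition algebra in `C`. -/
structure CA (C : Type u) [Category.{v} C] [MonoidalCategory C] [BraidedCategory C]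
    [Preadditive C] where
  X : C
  cup : X ⊗ X ⟶ 𝟙_ C
  mul : X ⊗ X ⟶ X
  one : 𝟙_ C ⟶ X
  isCA : IsCompositionAlgebra cup mul one

section Main

variable {C : Type u} [Category.{v} C] [MonoidalCategory C] [BraidedCategory C] [Preadditive C]

/-- A morphism of vector product algebras preserves both products. -/
@[ext]
structure VPA.Hom (V W : VPA C) where
  hom : V.X ⟶ W.X
  map_cup : (hom ⊗ₘ hom) ≫ W.cup = V.cup
  map_wedge : (hom ⊗ₘ hom) ≫ W.wedge = V.wedge ≫ hom

/-- A morphism of composition algebras preserves the inner product, the multiplication and the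
identity. -/
@[ext]
structure CA.Hom (A B : CA C) where
  hom : A.X ⟶ B.X
  map_cup : (hom ⊗ₘ hom) ≫ B.cup = A.cup
  map_mul : (hom ⊗ₘ hom) ≫ B.mul = A.mul ≫ hom
  map_one : A.one ≫ hom = B.one

instance : Category (VPA C) where
  Hom := VPA.Hom
  id V := { hom := 𝟙 V.X, map_cup := by simp, map_wedge := by simp }
  comp f g :=
    { hom := f.hom ≫ g.hom
      map_cup := by
        rw [← tensorHom_comp_tensorHom, Category.assoc, g.map_cup, f.map_cup]
      map_wedge := by
        rw [← tensorHom_comp_tensorHom, Category.assoc, g.map_wedge, ← Category.assoc,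
          f.map_wedge, Category.assoc] }
  id_comp f := VPA.Hom.ext (Category.id_comp f.hom)
  comp_id f := VPA.Hom.ext (Category.comp_id f.hom)
  assoc f g h := VPA.Hom.ext (Category.assoc f.hom g.hom h.hom)

instance : Category (CA C) where
  Hom := CA.Hom
  id A := { hom := 𝟙 A.X, map_cup := by simp, map_mul := by simp, map_one := by simp }
  comp f g :=
    { hom := f.hom ≫ g.hom
      map_cup := by
        rw [← tensorHom_comp_tensorHom, Category.assoc, g.map_cup, f.map_cup]
      map_mul := by
        rw [← tensorHom_comp_tensorHom, Category.assoc, g.map_mul, ← Category.assoc,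
          f.map_mul, Category.assoc]
      map_one := by rw [← Category.assoc, f.map_one, g.map_one] }
  id_comp f := CA.Hom.ext (Category.id_comp f.hom)
  comp_id f := CA.Hom.ext (Category.comp_id f.hom)
  assoc f g h := CA.Hom.ext (Category.assoc f.hom g.hom h.hom)

/-- The retraction `x ↦ x · e` of the identity of a composition algebra. -/
def CA.p (A : CA C) : A.X ⟶ 𝟙_ C :=
  (ρ_ A.X).inv ≫ A.X ◁ A.one ≫ A.cup

/-- A splitting of the idempotent `1 - e p` of a composition algebra `A` through an object `V`:
this is the complement of the unit `e : I ⟶ A` in a direct sum decomposition `A ≅ I ⊕ V`. -/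
structure CA.UnitComplement (A : CA C) where
  V : C
  i : V ⟶ A.X
  q : A.X ⟶ V
  i_q : i ≫ q = 𝟙 V
  q_i : q ≫ i = 𝟙 A.X - A.p ≫ A.one

/-- The wedge on a composition algebra: half of the commutator of the multiplication. -/
noncomputable def CA.wedge (h2 : TwoInvertible C) (A : CA C) : A.X ⊗ A.X ⟶ A.X :=
  half h2 (A.mul - (β_ A.X A.X).hom ≫ A.mul)

/-- The inner product restricted to the complement of the unit. -/
def CA.UnitComplement.cup {A : CA C} (S : A.UnitComplement) : S.V ⊗ S.V ⟶ 𝟙_ C :=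
  (S.i ⊗ₘ S.i) ≫ A.cup

/-- The wedge restricted to the complement of the unit. -/
noncomputable def CA.UnitComplement.wedge (h2 : TwoInvertible C) {A : CA C}
    (S : A.UnitComplement) : S.V ⊗ S.V ⟶ S.V :=
  (S.i ⊗ₘ S.i) ≫ A.wedge h2 ≫ S.q

theorem CA.one_p (A : CA C) : A.one ≫ A.p = 𝟙 _ := by
  have h := A.isCA.one_cup_one
  rw [CA.p, ← h, rightUnitor_inv_naturality_assoc, MonoidalCategory.tensorHom_def, unitors_inv_equal]
  simp

theorem CA.Hom.hom_p {A B : CA C} (f : CA.Hom A B) : f.hom ≫ B.p = A.p := by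
  rw [CA.p, CA.p, ← f.map_cup, ← f.map_one, rightUnitor_inv_naturality_assoc, MonoidalCategory.tensorHom_def]
  simp only [MonoidalCategory.whiskerLeft_comp, Category.assoc]
  rw [whisker_exchange_assoc]

theorem CA.UnitComplement.one_q {A : CA C} (S : A.UnitComplement) : A.one ≫ S.q = 0 := by
  have h : A.one ≫ S.q ≫ S.i = 0 := by
    rw [S.q_i, Preadditive.comp_sub, ← Category.assoc, A.one_p]
    simp
  calc A.one ≫ S.q = (A.one ≫ S.q ≫ S.i) ≫ S.q := by simp [S.i_q]
    _ = 0 := by rw [h, zero_comp]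

theorem CA.UnitComplement.i_p {A : CA C} (S : A.UnitComplement) : S.i ≫ A.p = 0 := by
  have h : S.q ≫ S.i ≫ A.p = 0 := by
    rw [← Category.assoc, S.q_i, Preadditive.sub_comp, Category.assoc, A.one_p]
    simp
  calc S.i ≫ A.p = S.i ≫ S.q ≫ S.i ≫ A.p := by rw [← Category.assoc S.i S.q, S.i_q]; simp
    _ = 0 := by rw [h, comp_zero]

/-- A morphism of composition algebras restricts along the complements of the units. -/
theorem CA.Hom.restrict {A B : CA C} (f : CA.Hom A B) (S : A.UnitComplement)
    (T : B.UnitComplement) : (S.i ≫ f.hom ≫ T.q) ≫ T.i = S.i ≫ f.hom := by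
  rw [Category.assoc, Category.assoc, T.q_i, Preadditive.comp_sub, Preadditive.comp_sub,
    ← Category.assoc f.hom B.p, f.hom_p, ← Category.assoc S.i A.p, S.i_p]
  simp

theorem CA.UnitComplement.q_i_hom_q {A B : CA C} (f : CA.Hom A B) (S : A.UnitComplement)
    (T : B.UnitComplement) : S.q ≫ S.i ≫ f.hom ≫ T.q = f.hom ≫ T.q := by
  rw [← Category.assoc S.q, S.q_i, Preadditive.sub_comp, Category.assoc, ← Category.assoc A.one,
    f.map_one, T.one_q]
  simp

theorem CA.Hom.map_commutator {A B : CA C} (h2 : TwoInvertible C) (f : CA.Hom A B) :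
    (f.hom ⊗ₘ f.hom) ≫ B.wedge h2 = A.wedge h2 ≫ f.hom := by
  apply (h2 _ _).1
  change (2 : ℤ) • _ = (2 : ℤ) • _
  rw [← Preadditive.comp_zsmul, ← Preadditive.zsmul_comp, CA.wedge, CA.wedge, two_half, two_half,
    Preadditive.comp_sub, Preadditive.sub_comp, f.map_mul, BraidedCategory.braiding_naturality_assoc,
    f.map_mul, Category.assoc]

/-- The functor sending a composition algebra `A` to the complement `V` of its unit, with the
restricted inner product and wedge, and a morphism to its restriction. It depends on a choice of
complements `S` and on a proof that these are vector product algebras. -/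
noncomputable def toVPA (h2 : TwoInvertible C) (S : ∀ A : CA C, A.UnitComplement)
    (hS : ∀ A : CA C, IsVectorProductAlgebra (S A).cup ((S A).wedge h2)) : CA C ⥤ VPA C where
  obj A := ⟨(S A).V, (S A).cup, (S A).wedge h2, hS A⟩
  map {A B} f :=
    { hom := (S A).i ≫ CA.Hom.hom f ≫ (S B).q
      map_cup := by
        change _ ≫ (_ ≫ _) = _ ≫ _
        rw [tensorHom_comp_tensorHom_assoc, CA.Hom.restrict, ← tensorHom_comp_tensorHom,
          Category.assoc, CA.Hom.map_cup]
      map_wedge := by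
        change _ ≫ (_ ≫ _) = (_ ≫ _) ≫ _
        rw [tensorHom_comp_tensorHom_assoc, CA.Hom.restrict, ← tensorHom_comp_tensorHom,
          Category.assoc, ← Category.assoc _ (B.wedge h2), CA.Hom.map_commutator]
        simp only [Category.assoc]
        rw [CA.UnitComplement.q_i_hom_q] }
  map_id A := VPA.Hom.ext (by
    change (S A).i ≫ 𝟙 A.X ≫ (S A).q = 𝟙 (S A).V
    rw [Category.id_comp, (S A).i_q])
  map_comp {A B D} f g := VPA.Hom.ext (by
    change (S A).i ≫ (CA.Hom.hom f ≫ CA.Hom.hom g) ≫ (S D).q =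
      ((S A).i ≫ CA.Hom.hom f ≫ (S B).q) ≫ (S B).i ≫ CA.Hom.hom g ≫ (S D).q
    rw [← Category.assoc _ (S B).i, CA.Hom.restrict]
    simp only [Category.assoc])

variable [HasFiniteBiproducts C]

/-- The underlying object `I ⊕ V` of the composition algebra of a vector product algebra `V`. -/
noncomputable def VPA.sumObj (V : VPA C) : C := 𝟙_ C ⊞ V.X

/-- The first projection `p : I ⊕ V ⟶ I`. -/
noncomputable def VPA.p (V : VPA C) : V.sumObj ⟶ 𝟙_ C := biprod.fst

/-- The second projection `q : I ⊕ V ⟶ V`. -/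
noncomputable def VPA.q (V : VPA C) : V.sumObj ⟶ V.X := biprod.snd

/-- The first inclusion `e : I ⟶ I ⊕ V`. -/
noncomputable def VPA.e (V : VPA C) : 𝟙_ C ⟶ V.sumObj := biprod.inl

/-- The second inclusion `i : V ⟶ I ⊕ V`. -/
noncomputable def VPA.i (V : VPA C) : V.X ⟶ V.sumObj := biprod.inr

/-- The inner product `(a, x) · (b, y) = a b + x · y` on `I ⊕ V`. -/
noncomputable def VPA.sumCup (V : VPA C) : V.sumObj ⊗ V.sumObj ⟶ 𝟙_ C :=
  (V.q ⊗ₘ V.q) ≫ V.cup + (V.p ⊗ₘ V.p) ≫ (λ_ (𝟙_ C)).hom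

/-- The multiplication `(a, x) (b, y) = (a b - x · y, a y + b x + x ∧ y)` on `I ⊕ V`. -/
noncomputable def VPA.sumMul (V : VPA C) : V.sumObj ⊗ V.sumObj ⟶ V.sumObj :=
  ((V.p ⊗ₘ V.p) ≫ (λ_ (𝟙_ C)).hom - (V.q ⊗ₘ V.q) ≫ V.cup) ≫ V.e
    + ((V.p ⊗ₘ V.q) ≫ (λ_ V.X).hom + (V.q ⊗ₘ V.p) ≫ (ρ_ V.X).hom
        + (V.q ⊗ₘ V.q) ≫ V.wedge) ≫ V.i

/-- The morphism `1 ⊕ g : I ⊕ V ⟶ I ⊕ W`. -/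
noncomputable def VPA.Hom.sumMap {V W : VPA C} (g : VPA.Hom V W) : V.sumObj ⟶ W.sumObj :=
  biprod.map (𝟙 (𝟙_ C)) g.hom

theorem VPA.Hom.sumMap_p {V W : VPA C} (g : VPA.Hom V W) : g.sumMap ≫ W.p = V.p := by
  simp [VPA.Hom.sumMap, VPA.p, VPA.sumObj]

theorem VPA.Hom.sumMap_q {V W : VPA C} (g : VPA.Hom V W) : g.sumMap ≫ W.q = V.q ≫ g.hom := by
  simp [VPA.Hom.sumMap, VPA.q, VPA.sumObj]

theorem VPA.Hom.e_sumMap {V W : VPA C} (g : VPA.Hom V W) : V.e ≫ g.sumMap = W.e := by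
  simp [VPA.Hom.sumMap, VPA.e, VPA.sumObj]

theorem VPA.Hom.i_sumMap {V W : VPA C} (g : VPA.Hom V W) : V.i ≫ g.sumMap = g.hom ≫ W.i := by
  simp [VPA.Hom.sumMap, VPA.i, VPA.sumObj]

/-- The functor sending a vector product algebra `V` to `I ⊕ V` with the inner product,
multiplication and identity above. It depends on a proof that these are composition algebras. -/
noncomputable def toCA
    (hA : ∀ V : VPA C, IsCompositionAlgebra V.sumCup V.sumMul V.e) : VPA C ⥤ CA C where
  obj V := ⟨V.sumObj, V.sumCup, V.sumMul, V.e, hA V⟩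
  map {V W} g :=
    { hom := VPA.Hom.sumMap g
      map_cup := by
        simp only [VPA.sumCup, Preadditive.comp_add, tensorHom_comp_tensorHom_assoc,
          VPA.Hom.sumMap_p, VPA.Hom.sumMap_q]
        rw [← tensorHom_comp_tensorHom, Category.assoc, VPA.Hom.map_cup]
      map_mul := by
        have h1 : (V.q ≫ VPA.Hom.hom g ⊗ₘ V.q ≫ VPA.Hom.hom g) ≫ W.cup
            = (V.q ⊗ₘ V.q) ≫ V.cup := by
          rw [← tensorHom_comp_tensorHom, Category.assoc, VPA.Hom.map_cup]
        have h2 : (V.q ≫ VPA.Hom.hom g ⊗ₘ V.q ≫ VPA.Hom.hom g) ≫ W.wedge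
            = (V.q ⊗ₘ V.q) ≫ V.wedge ≫ VPA.Hom.hom g := by
          rw [← tensorHom_comp_tensorHom, Category.assoc, VPA.Hom.map_wedge]
        have h3 : (V.p ⊗ₘ V.q ≫ VPA.Hom.hom g) ≫ (λ_ W.X).hom
            = (V.p ⊗ₘ V.q) ≫ (λ_ V.X).hom ≫ VPA.Hom.hom g := by
          simp [MonoidalCategory.tensorHom_def]
        have h4 : (V.q ≫ VPA.Hom.hom g ⊗ₘ V.p) ≫ (ρ_ W.X).hom
            = (V.q ⊗ₘ V.p) ≫ (ρ_ V.X).hom ≫ VPA.Hom.hom g := by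
          simp [MonoidalCategory.tensorHom_def']
        simp only [VPA.sumMul, Preadditive.comp_add, Preadditive.add_comp, Preadditive.comp_sub,
          Preadditive.sub_comp, tensorHom_comp_tensorHom_assoc, VPA.Hom.sumMap_p,
          VPA.Hom.sumMap_q, Category.assoc, VPA.Hom.e_sumMap, VPA.Hom.i_sumMap]
        rw [reassoc_of% h1, reassoc_of% h2, reassoc_of% h3, reassoc_of% h4]
      map_one := VPA.Hom.e_sumMap g }
  map_id V := CA.Hom.ext (by
    change biprod.map (𝟙 (𝟙_ C)) (𝟙 V.X) = 𝟙 (𝟙_ C ⊞ V.X)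
    ext <;> simp)
  map_comp {U V W} f g := CA.Hom.ext (by
    change biprod.map (𝟙 (𝟙_ C)) (VPA.Hom.hom f ≫ VPA.Hom.hom g) =
      biprod.map (𝟙 (𝟙_ C)) (VPA.Hom.hom f) ≫ biprod.map (𝟙 (𝟙_ C)) (VPA.Hom.hom g)
    ext <;> simp)

end Main

end BraidedAlg

/-! The classical picture guides the proof. A composition algebra is governed by its part V
orthogonal to e, where xy = x ∧ y − (x·y)e, so multiplication and vector product determine each
other; what must be shown is that the two sets of axioms correspond. Elements are replaced by
strands, and permutations of arguments by braids.

From A to V: putting e into one argument of the composition law gives trilinear identities. On V,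
where p vanishes, they say that (xy)·z = x·(yz) and that braiding y past z changes the sign
(`IsSplitUnital.incl_triple_of_composition`). Together with p(xy) = 2p(x)p(y) − x·y and
nondegeneracy this gives xy + yx = −2(x·y)e on V, hence the formula for xy
(`IsSplitUnital.mulIncl_of_composition`). The triple product (x ∧ y)·z is then alternating, and on
four arguments from V the composition law involves only ∧ and the inner product.

The double wedge axiom, paired with a fourth vector, becomes `QuadIdentity`, and nondegeneracy makes
this reversible. For an alternating triple product, `IsAlternating.quadIdentity_iff` identifies
`QuadIdentity` with the composition law on V. Here the braiding needs care: different braids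
inducing the same permutation must be shown to act alike on (x ∧ y)·(z ∧ u), which is
`IsAlternating.br12_wedgePair`.

From V to I ⊕ V: by additivity the composition law is checked with e in some slot, where it reduces
to the trilinear identities, and with all arguments in V, where it is `QuadIdentity`
(`IsSplitUnital.composition_of_quadIdentity`).

For the equivalence, the blocks of the inner product and of the multiplication on A are all forced,
so (p, q) is an isomorphism of algebras from A to I ⊕ V; and any complement of e in I ⊕ V projects
isomorphically onto V. -/

namespace BraidedAlg

/-! ### Operations on the leading strands of a right-nested tensor product, with spectators P -/

section Strands

variable {C : Type u} [Category.{v} C] [MonoidalCategory C]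

/-- A binary operation on the first two strands. -/
def opL {X Y Z : C} (f : X ⊗ Y ⟶ Z) (P : C) : X ⊗ Y ⊗ P ⟶ Z ⊗ P := (α_ X Y P).inv ≫ f ▷ P

/-- A pairing of the first two strands. -/
def cupL {X Y : C} (k : X ⊗ Y ⟶ 𝟙_ C) (P : C) : X ⊗ Y ⊗ P ⟶ P :=
  (α_ X Y P).inv ≫ k ▷ P ≫ (λ_ P).hom

/-- A copairing inserted before the first strand. -/
def copL {X Y : C} (d : 𝟙_ C ⟶ X ⊗ Y) (P : C) : P ⟶ X ⊗ Y ⊗ P :=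
  (λ_ P).inv ≫ d ▷ P ≫ (α_ X Y P).hom

/-- A point inserted before the first strand. -/
def ptL {X : C} (e : 𝟙_ C ⟶ X) (P : C) : P ⟶ X ⊗ P := (λ_ P).inv ≫ e ▷ P

/-- A form applied to the first strand. -/
def formL {X : C} (p : X ⟶ 𝟙_ C) (P : C) : X ⊗ P ⟶ P := p ▷ P ≫ (λ_ P).hom

section Naturality

variable {X Y Z P Q : C}

theorem opL_natural (f : X ⊗ Y ⟶ Z) (g : P ⟶ Q) :
    opL f P ≫ Z ◁ g = X ◁ Y ◁ g ≫ opL f Q := by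
  rw [opL, Category.assoc, ← whisker_exchange]
  simp [opL]

theorem cupL_natural (k : X ⊗ Y ⟶ 𝟙_ C) (g : P ⟶ Q) :
    cupL k P ≫ g = X ◁ Y ◁ g ≫ cupL k Q := by
  rw [cupL, Category.assoc, Category.assoc, ← leftUnitor_naturality, ← whisker_exchange_assoc]
  simp [cupL]

theorem copL_natural (d : 𝟙_ C ⟶ X ⊗ Y) (g : P ⟶ Q) :
    g ≫ copL d Q = copL d P ≫ X ◁ Y ◁ g := by
  rw [copL, leftUnitor_inv_naturality_assoc, whisker_exchange_assoc]
  simp [copL]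

theorem ptL_natural (e : 𝟙_ C ⟶ X) (g : P ⟶ Q) : g ≫ ptL e Q = ptL e P ≫ X ◁ g := by
  rw [ptL, leftUnitor_inv_naturality_assoc, whisker_exchange]
  simp [ptL]

theorem formL_natural (p : X ⟶ 𝟙_ C) (g : P ⟶ Q) : formL p P ≫ g = X ◁ g ≫ formL p Q := by
  rw [formL, Category.assoc, ← leftUnitor_naturality, ← whisker_exchange_assoc]
  simp [formL]

end Naturality

variable [BraidedCategory C]

/-- The braiding of the first two strands. -/
def brL (X Y P : C) : X ⊗ Y ⊗ P ⟶ Y ⊗ X ⊗ P :=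
  (α_ X Y P).inv ≫ (β_ X Y).hom ▷ P ≫ (α_ Y X P).hom

instance (X Y P : C) : IsIso (brL X Y P) := by unfold brL; infer_instance

theorem brL_natural (X Y : C) {P Q : C} (g : P ⟶ Q) :
    brL X Y P ≫ Y ◁ X ◁ g = X ◁ Y ◁ g ≫ brL X Y Q := by
  rw [brL, Category.assoc, Category.assoc, ← associator_naturality_right, ← whisker_exchange_assoc]
  simp [brL]

theorem brL_left {X X' : C} (f : X ⟶ X') (Y P : C) :
    f ▷ (Y ⊗ P) ≫ brL X' Y P = brL X Y P ≫ Y ◁ f ▷ P := by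
  rw [brL, associator_inv_naturality_left_assoc, ← comp_whiskerRight_assoc,
    BraidedCategory.braiding_naturality_left]
  simp [brL]

theorem brL_right (X : C) {Y Y' : C} (f : Y ⟶ Y') (P : C) :
    X ◁ f ▷ P ≫ brL X Y' P = brL X Y P ≫ f ▷ (X ⊗ P) := by
  rw [brL, associator_inv_naturality_middle_assoc, ← comp_whiskerRight_assoc,
    BraidedCategory.braiding_naturality_right]
  simp [brL]

/-- The hexagon identities in strand form. -/
theorem brL_tensor_left (X Y Z P : C) :
    (α_ X Y (Z ⊗ P)).inv ≫ brL (X ⊗ Y) Z P =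
      X ◁ brL Y Z P ≫ brL X Z (Y ⊗ P) ≫ Z ◁ (α_ X Y P).inv := by
  simp [brL]

theorem brL_tensor_right (X Y Z P : C) :
    X ◁ (α_ Y Z P).inv ≫ brL X (Y ⊗ Z) P =
      brL X Y (Z ⊗ P) ≫ Y ◁ brL X Z P ≫ (α_ Y Z (X ⊗ P)).inv := by
  simp [brL]

theorem yang_baxterL (X Y Z P : C) :
    brL X Y (Z ⊗ P) ≫ Y ◁ brL X Z P ≫ brL Y Z (X ⊗ P) =
      X ◁ brL Y Z P ≫ brL X Z (Y ⊗ P) ≫ Z ◁ brL X Y P := by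
  have h := congrArg (fun t => X ◁ (α_ Y Z P).inv ≫ (α_ X (Y ⊗ Z) P).inv ≫
    t ▷ P ≫ (α_ Z (Y ⊗ X) P).hom ≫ Z ◁ (α_ Y X P).hom)
    (BraidedCategory.yang_baxter X Y Z)
  simpa [brL] using h

theorem brL_unit_left (Z P : C) :
    (λ_ (Z ⊗ P)).inv ≫ brL (𝟙_ C) Z P = Z ◁ (λ_ P).inv := by
  simp [brL, braiding_tensorUnit_left]

theorem brL_unit_right (Z P : C) :
    Z ◁ (λ_ P).inv ≫ brL Z (𝟙_ C) P = (λ_ (Z ⊗ P)).inv := by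
  simp [brL, braiding_tensorUnit_right]

variable {X Y Z : C}

/-- Naturality of the braiding slides f through the crossing, and the hexagon splits the crossing of
X ⊗ Y into two. -/
theorem opL_brL (f : X ⊗ Y ⟶ Z) (W P : C) :
    opL f (W ⊗ P) ≫ brL Z W P = X ◁ brL Y W P ≫ brL X W (Y ⊗ P) ≫ W ◁ opL f P := by
  rw [opL, Category.assoc, brL_left, reassoc_of% brL_tensor_left X Y W P, opL, whiskerLeft_comp]

theorem whiskerLeft_opL_brL (f : X ⊗ Y ⟶ Z) (W P : C) :
    W ◁ opL f P ≫ brL W Z P = brL W X (Y ⊗ P) ≫ X ◁ brL W Y P ≫ opL f (W ⊗ P) := by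
  rw [opL, whiskerLeft_comp, Category.assoc, brL_right, reassoc_of% brL_tensor_right W X Y P, opL]

theorem ptL_brL (e : 𝟙_ C ⟶ X) (W P : C) : ptL e (W ⊗ P) ≫ brL X W P = W ◁ ptL e P := by
  rw [ptL, Category.assoc, brL_left, reassoc_of% brL_unit_left W P, ptL, whiskerLeft_comp]

theorem whiskerLeft_ptL_brL (e : 𝟙_ C ⟶ X) (W P : C) :
    W ◁ ptL e P ≫ brL W X P = ptL e (W ⊗ P) := by
  rw [ptL, whiskerLeft_comp, Category.assoc, brL_right, reassoc_of% brL_unit_right W P, ptL]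

/-- A strand can be pulled across a cup, because the braiding with the unit object is trivial. -/
theorem cupL_eq_brL (k : X ⊗ Y ⟶ 𝟙_ C) (W P : C) :
    cupL k (W ⊗ P) = X ◁ brL Y W P ≫ brL X W (Y ⊗ P) ≫ W ◁ cupL k P := by
  have h : cupL k (W ⊗ P) = opL k (W ⊗ P) ≫ brL (𝟙_ C) W P ≫ W ◁ (λ_ P).hom := by
    simp [cupL, opL, brL, braiding_tensorUnit_left]
  rw [h, reassoc_of% opL_brL k W P, ← whiskerLeft_comp, opL, cupL, Category.assoc]

end Strands

/-! ### Self-dualities through copairings -/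

section Duality

variable {C : Type u} [Category.{v} C] [MonoidalCategory C]

/-- `d` is the copairing inverse to the pairing `k`, as seen on strands. -/
structure IsCopairing {A : C} (k : A ⊗ A ⟶ 𝟙_ C) (d : 𝟙_ C ⟶ A ⊗ A) : Prop where
  zig (P : C) : copL d (A ⊗ P) ≫ A ◁ cupL k P = 𝟙 (A ⊗ P)
  zag (P : C) : A ◁ copL d P ≫ cupL k (A ⊗ P) = 𝟙 (A ⊗ P)

theorem IsCopairing.of_zigzag {A : C} {k : A ⊗ A ⟶ 𝟙_ C} {d : 𝟙_ C ⟶ A ⊗ A}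
    (h₁ : d ▷ A ≫ (α_ A A A).hom ≫ A ◁ k = (λ_ A).hom ≫ (ρ_ A).inv)
    (h₂ : A ◁ d ≫ (α_ A A A).inv ≫ k ▷ A = (ρ_ A).hom ≫ (λ_ A).inv) : IsCopairing k d where
  zig P := by
    have h := congrArg (fun t => (λ_ (A ⊗ P)).inv ≫ (α_ (𝟙_ C) A P).inv ≫ t ▷ P ≫
      (α_ A (𝟙_ C) P).hom ≫ A ◁ (λ_ P).hom) h₁
    simpa [copL, cupL] using h
  zag P := by
    have h := congrArg (fun t => A ◁ (λ_ P).inv ≫ (α_ A (𝟙_ C) P).inv ≫ t ▷ P ≫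
      (α_ (𝟙_ C) A P).hom ≫ (λ_ (A ⊗ P)).hom) h₂
    simpa [copL, cupL] using h

/-- Surjectivity supplies d as a preimage of the identity of A, which is one triangle identity;
injectivity forces the other. -/
theorem IsDualityCounit.exists_copairing {A : C} {k : A ⊗ A ⟶ 𝟙_ C} (hk : IsDualityCounit k) :
    ∃ d, IsCopairing k d := by
  obtain ⟨d, hd⟩ := (hk (𝟙_ C) A).2 (λ_ A).hom
  have h₁ : d ▷ A ≫ (α_ A A A).hom ≫ A ◁ k = (λ_ A).hom ≫ (ρ_ A).inv := by
    rw [← hd]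
    simp
  refine ⟨d, IsCopairing.of_zigzag h₁ ?_⟩
  -- After pairing with one more strand, interchanging the two cups exposes the triangle already
  -- known.
  have key : (ρ_ A).inv ≫ A ◁ d ≫ (α_ A A A).inv ≫ k ▷ A = (λ_ A).inv := by
    apply (hk A (𝟙_ C)).1
    calc ((ρ_ A).inv ≫ A ◁ d ≫ (α_ A A A).inv ≫ k ▷ A) ▷ A ≫ (α_ (𝟙_ C) A A).hom ≫
          𝟙_ C ◁ k ≫ (ρ_ (𝟙_ C)).hom
        = 𝟙 _ ⊗≫ A ◁ d ▷ A ⊗≫ (k ▷ (A ⊗ A) ≫ 𝟙_ C ◁ k) ⊗≫ 𝟙 _ := by monoidal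
      _ = 𝟙 _ ⊗≫ A ◁ (d ▷ A ≫ (α_ A A A).hom ≫ A ◁ k) ⊗≫ k ⊗≫ 𝟙 _ := by
        rw [← whisker_exchange]; monoidal
      _ = (λ_ A).inv ▷ A ≫ (α_ (𝟙_ C) A A).hom ≫ 𝟙_ C ◁ k ≫ (ρ_ (𝟙_ C)).hom := by
        rw [h₁]; monoidal
  rw [← key]
  simp

theorem IsCopairing.isDualityCounit {A : C} {k : A ⊗ A ⟶ 𝟙_ C} {d : 𝟙_ C ⟶ A ⊗ A}
    (h : IsCopairing k d) : IsDualityCounit k := by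
  let _ : ExactPairing A A :=
    { coevaluation' := d
      evaluation' := k
      coevaluation_evaluation' := by
        have := congrArg (fun t => t ≫ (ρ_ A).hom ≫ (λ_ A).inv) (h.zag (𝟙_ C))
        rw [Category.id_comp] at this
        rw [← this, copL, cupL]
        monoidal
      evaluation_coevaluation' := by
        have := congrArg (fun t => (λ_ A).hom ≫ (ρ_ A).inv ≫ t) (h.zig (𝟙_ C))
        rw [Category.comp_id] at this
        rw [← this, copL, cupL]
        monoidal }
  exact fun X Y => (tensorRightHomEquiv X A A Y).symm.bijective

variable {A : C} {k : A ⊗ A ⟶ 𝟙_ C} {d : 𝟙_ C ⟶ A ⊗ A}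

/-- Morphisms into a strand which is self-dual are determined by pairing from the left. -/
theorem IsCopairing.cancel_left (h : IsCopairing k d) {Q P : C} {f g : Q ⟶ A ⊗ P}
    (hfg : A ◁ f ≫ cupL k P = A ◁ g ≫ cupL k P) : f = g := by
  -- The copairing rebuilds f from its pairing: slide f past the copairing and straighten the
  -- zigzag.
  have key (f : Q ⟶ A ⊗ P) : copL d Q ≫ A ◁ (A ◁ f ≫ cupL k P) = f := by
    rw [whiskerLeft_comp, ← reassoc_of% copL_natural d f, h.zig, Category.comp_id]
  rw [← key f, ← key g, hfg]

end Duality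

section Whisker

variable {C : Type u} [Category.{v} C] [MonoidalCategory C] [Preadditive C] [MonoidalPreadditive C]

theorem whiskerLeft_zsmul' (X : C) {Y Z : C} (n : ℤ) (f : Y ⟶ Z) : X ◁ (n • f) = n • X ◁ f :=
  (tensoringLeft C |>.obj X).map_zsmul

theorem zsmul_whiskerRight' {Y Z : C} (n : ℤ) (f : Y ⟶ Z) (X : C) : (n • f) ▷ X = n • f ▷ X :=
  (tensoringRight C |>.obj X).map_zsmul

theorem whiskerLeft_neg' (X : C) {Y Z : C} (f : Y ⟶ Z) : X ◁ (-f) = -X ◁ f :=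
  (tensoringLeft C |>.obj X).map_neg

theorem neg_whiskerRight' {Y Z : C} (f : Y ⟶ Z) (X : C) : (-f) ▷ X = -f ▷ X :=
  (tensoringRight C |>.obj X).map_neg

theorem whiskerLeft_sub' (X : C) {Y Z : C} (f g : Y ⟶ Z) : X ◁ (f - g) = X ◁ f - X ◁ g :=
  (tensoringLeft C |>.obj X).map_sub

theorem sub_whiskerRight' {Y Z : C} (f g : Y ⟶ Z) (X : C) : (f - g) ▷ X = f ▷ X - g ▷ X :=
  (tensoringRight C |>.obj X).map_sub

end Whisker

/-! ### The axioms translated into strand form -/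

section Axioms

variable {C : Type u} [Category.{v} C] [MonoidalCategory C] [BraidedCategory C]

/-- In this and the following translations, whiskering with P gives the strand form, and P = I
recovers the axiom. -/
theorem brL_cupL_iff {A : C} (k : A ⊗ A ⟶ 𝟙_ C) :
    (β_ A A).hom ≫ k = k ↔ ∀ P, brL A A P ≫ cupL k P = cupL k P := by
  constructor
  · intro h P
    have := congrArg (fun t => (α_ A A P).inv ≫ t ▷ P ≫ (λ_ P).hom) h
    simpa [brL, cupL] using this
  · intro h
    have h₁ : (ρ_ _).inv ≫ (α_ A A (𝟙_ C)).hom ≫ (brL A A (𝟙_ C) ≫ cupL k (𝟙_ C)) =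
        (β_ A A).hom ≫ k := by
      simp only [brL, cupL]; monoidal
    have h₂ : (ρ_ _).inv ≫ (α_ A A (𝟙_ C)).hom ≫ cupL k (𝟙_ C) = k := by
      simp only [cupL]; monoidal
    rw [← h₁, h, h₂]

theorem cyclic_iff {V : C} (k : V ⊗ V ⟶ 𝟙_ C) (w : V ⊗ V ⟶ V) :
    w ▷ V ≫ k = (β_ (V ⊗ V) V).hom ≫ (α_ V V V).inv ≫ w ▷ V ≫ k ↔
    ∀ P, opL w (V ⊗ P) ≫ cupL k P =
      V ◁ brL V V P ≫ brL V V (V ⊗ P) ≫ opL w (V ⊗ P) ≫ cupL k P := by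
  constructor
  · intro h P
    have := congrArg (fun t => (α_ V V (V ⊗ P)).inv ≫ (α_ (V ⊗ V) V P).inv ≫ t ▷ P ≫ (λ_ P).hom) h
    simpa [brL, opL, cupL] using this
  · intro h
    have h₁ : (ρ_ _).inv ≫ (α_ (V ⊗ V) V (𝟙_ C)).hom ≫ (α_ V V (V ⊗ 𝟙_ C)).hom ≫
        (opL w (V ⊗ 𝟙_ C) ≫ cupL k (𝟙_ C)) = w ▷ V ≫ k := by
      simp only [opL, cupL]; monoidal
    have h₂ : (ρ_ _).inv ≫ (α_ (V ⊗ V) V (𝟙_ C)).hom ≫ (α_ V V (V ⊗ 𝟙_ C)).hom ≫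
        (V ◁ brL V V (𝟙_ C) ≫ brL V V (V ⊗ 𝟙_ C) ≫ opL w (V ⊗ 𝟙_ C) ≫ cupL k (𝟙_ C)) =
          (β_ (V ⊗ V) V).hom ≫ (α_ V V V).inv ≫ w ▷ V ≫ k := by
      simp only [brL, opL, cupL, BraidedCategory.braiding_tensor_left_hom]; monoidal
    rw [← h₂, ← h, h₁]

variable [Preadditive C] [MonoidalPreadditive C]

theorem brL_opL_iff {V : C} (w : V ⊗ V ⟶ V) :
    w = -((β_ V V).hom ≫ w) ↔ ∀ P, brL V V P ≫ opL w P = -opL w P := by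
  rw [eq_neg_iff_add_eq_zero, add_comm, ← eq_neg_iff_add_eq_zero]
  constructor
  · intro h P
    have := congrArg (fun t => (α_ V V P).inv ≫ t ▷ P) h
    simpa [brL, opL, neg_whiskerRight'] using this
  · intro h
    have h₁ : (ρ_ _).inv ≫ (α_ V V (𝟙_ C)).hom ≫ (brL V V (𝟙_ C) ≫ opL w (𝟙_ C)) ≫ (ρ_ V).hom =
        (β_ V V).hom ≫ w := by
      simp only [brL, opL]; monoidal
    have h₂ : (ρ_ _).inv ≫ (α_ V V (𝟙_ C)).hom ≫ opL w (𝟙_ C) ≫ (ρ_ V).hom = w := by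
      simp only [opL]; monoidal
    rw [← h₁, h, Preadditive.neg_comp, Preadditive.comp_neg, Preadditive.comp_neg, h₂]

theorem wedge_wedge_iff {V : C} (k : V ⊗ V ⟶ 𝟙_ C) (w : V ⊗ V ⟶ V) :
    w ▷ V ≫ w + (α_ V V V).hom ≫ V ◁ w ≫ w =
    (2 : ℤ) • ((β_ V V).hom ▷ V ≫ (α_ V V V).hom ≫ V ◁ k ≫ (ρ_ V).hom)
      - k ▷ V ≫ (λ_ V).hom - (α_ V V V).hom ≫ V ◁ k ≫ (ρ_ V).hom ↔
    ∀ P, opL w (V ⊗ P) ≫ opL w P + V ◁ opL w P ≫ opL w P =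
      (2 : ℤ) • (brL V V (V ⊗ P) ≫ V ◁ cupL k P) - cupL k (V ⊗ P) - V ◁ cupL k P := by
  constructor
  · intro h P
    have := congrArg (fun t => (α_ V V (V ⊗ P)).inv ≫ (α_ (V ⊗ V) V P).inv ≫ t ▷ P) h
    simpa [brL, opL, cupL, zsmul_whiskerRight', sub_whiskerRight'] using this
  · intro h
    have h₁ : (ρ_ _).inv ≫ (α_ (V ⊗ V) V (𝟙_ C)).hom ≫ (α_ V V (V ⊗ 𝟙_ C)).hom ≫
        (opL w (V ⊗ 𝟙_ C) ≫ opL w (𝟙_ C)) ≫ (ρ_ V).hom = w ▷ V ≫ w := by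
      simp only [opL]; monoidal
    have h₂ : (ρ_ _).inv ≫ (α_ (V ⊗ V) V (𝟙_ C)).hom ≫ (α_ V V (V ⊗ 𝟙_ C)).hom ≫
        (V ◁ opL w (𝟙_ C) ≫ opL w (𝟙_ C)) ≫ (ρ_ V).hom = (α_ V V V).hom ≫ V ◁ w ≫ w := by
      simp only [opL]; monoidal
    have h₃ : (ρ_ _).inv ≫ (α_ (V ⊗ V) V (𝟙_ C)).hom ≫ (α_ V V (V ⊗ 𝟙_ C)).hom ≫
        (brL V V (V ⊗ 𝟙_ C) ≫ V ◁ cupL k (𝟙_ C)) ≫ (ρ_ V).hom =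
          (β_ V V).hom ▷ V ≫ (α_ V V V).hom ≫ V ◁ k ≫ (ρ_ V).hom := by
      simp only [brL, cupL]; monoidal
    have h₄ : (ρ_ _).inv ≫ (α_ (V ⊗ V) V (𝟙_ C)).hom ≫ (α_ V V (V ⊗ 𝟙_ C)).hom ≫
        cupL k (V ⊗ 𝟙_ C) ≫ (ρ_ V).hom = k ▷ V ≫ (λ_ V).hom := by
      simp only [cupL]; monoidal
    have h₅ : (ρ_ _).inv ≫ (α_ (V ⊗ V) V (𝟙_ C)).hom ≫ (α_ V V (V ⊗ 𝟙_ C)).hom ≫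
        V ◁ cupL k (𝟙_ C) ≫ (ρ_ V).hom = (α_ V V V).hom ≫ V ◁ k ≫ (ρ_ V).hom := by
      simp only [cupL]; monoidal
    have := congrArg (fun t => (ρ_ _).inv ≫ (α_ (V ⊗ V) V (𝟙_ C)).hom ≫
      (α_ V V (V ⊗ 𝟙_ C)).hom ≫ t ≫ (ρ_ V).hom) (h (𝟙_ C))
    simp only [Preadditive.comp_add, Preadditive.add_comp, Preadditive.comp_sub,
      Preadditive.sub_comp, Preadditive.comp_zsmul, Preadditive.zsmul_comp] at this
    rwa [h₁, h₂, h₃, h₄, h₅] at this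

/-- All three terms differ from their strand forms by whiskering with P and the same coherence
isomorphisms, which can therefore be cancelled. -/
theorem composition_iff {A : C} (k : A ⊗ A ⟶ 𝟙_ C) (m : A ⊗ A ⟶ A) :
    tensorμ A A A A ≫ (m ⊗ₘ m) ≫ k
      + (α_ A A (A ⊗ A)).hom ≫ A ◁ ((α_ A A A).inv ≫ (β_ (A ⊗ A) A).hom) ≫
          (α_ A A (A ⊗ A)).inv ≫ (m ⊗ₘ m) ≫ k =
    (2 : ℤ) • ((k ⊗ₘ k) ≫ (λ_ (𝟙_ C)).hom) ↔
    ∀ P, A ◁ brL A A (A ⊗ P) ≫ opL m (A ⊗ A ⊗ P) ≫ A ◁ opL m P ≫ cupL k P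
      + A ◁ A ◁ brL A A P ≫ A ◁ brL A A (A ⊗ P) ≫ opL m (A ⊗ A ⊗ P) ≫ A ◁ opL m P ≫ cupL k P =
    (2 : ℤ) • (cupL k (A ⊗ A ⊗ P) ≫ cupL k P) := by
  have h₁ (P : C) : A ◁ brL A A (A ⊗ P) ≫ opL m (A ⊗ A ⊗ P) ≫ A ◁ opL m P ≫ cupL k P =
      (A ◁ A ◁ (α_ A A P).inv ≫ (α_ A A ((A ⊗ A) ⊗ P)).inv ≫ (α_ (A ⊗ A) (A ⊗ A) P).inv) ≫
        (tensorμ A A A A ≫ (m ⊗ₘ m) ≫ k) ▷ P ≫ (λ_ P).hom := by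
    simp only [brL, opL, cupL, tensorμ, MonoidalCategory.tensorHom_def]
    monoidal
  have h₂ (P : C) : A ◁ A ◁ brL A A P ≫ A ◁ brL A A (A ⊗ P) ≫ opL m (A ⊗ A ⊗ P) ≫
        A ◁ opL m P ≫ cupL k P =
      (A ◁ A ◁ (α_ A A P).inv ≫ (α_ A A ((A ⊗ A) ⊗ P)).inv ≫ (α_ (A ⊗ A) (A ⊗ A) P).inv) ≫
        ((α_ A A (A ⊗ A)).hom ≫ A ◁ ((α_ A A A).inv ≫ (β_ (A ⊗ A) A).hom) ≫
          (α_ A A (A ⊗ A)).inv ≫ (m ⊗ₘ m) ≫ k) ▷ P ≫ (λ_ P).hom := by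
    simp only [brL, opL, cupL, MonoidalCategory.tensorHom_def,
      BraidedCategory.braiding_tensor_left_hom]
    monoidal
  have h₃ (P : C) : cupL k (A ⊗ A ⊗ P) ≫ cupL k P =
      (A ◁ A ◁ (α_ A A P).inv ≫ (α_ A A ((A ⊗ A) ⊗ P)).inv ≫ (α_ (A ⊗ A) (A ⊗ A) P).inv) ≫
        ((k ⊗ₘ k) ≫ (λ_ (𝟙_ C)).hom) ▷ P ≫ (λ_ P).hom := by
    simp only [cupL, MonoidalCategory.tensorHom_def]
    monoidal
  constructor
  · intro h P
    rw [h₂, h₁, h₃, ← Preadditive.comp_add, ← Preadditive.add_comp,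
      ← MonoidalPreadditive.add_whiskerRight, h, zsmul_whiskerRight', Preadditive.zsmul_comp,
      Preadditive.comp_zsmul]
  · intro h
    have := h (𝟙_ C)
    rwa [h₂, h₁, h₃, ← Preadditive.comp_add, ← Preadditive.add_comp,
      ← MonoidalPreadditive.add_whiskerRight, ← Preadditive.comp_zsmul, ← Preadditive.zsmul_comp,
      ← zsmul_whiskerRight', cancel_epi, cancel_mono, whiskerRight_iff] at this

end Axioms

/-! ### Products of two inner products -/

section Pairings

variable {C : Type u} [Category.{v} C] [MonoidalCategory C] [BraidedCategory C]

/-- The pairing `(x · y) (z · u)`. -/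
def cupPair {V : C} (k : V ⊗ V ⟶ 𝟙_ C) (P : C) : V ⊗ V ⊗ V ⊗ V ⊗ P ⟶ P :=
  cupL k (V ⊗ V ⊗ P) ≫ cupL k P

/-- The pairing `(x · u) (y · z)`. -/
def cupNest {V : C} (k : V ⊗ V ⟶ 𝟙_ C) (P : C) : V ⊗ V ⊗ V ⊗ V ⊗ P ⟶ P :=
  V ◁ cupL k (V ⊗ P) ≫ cupL k P

variable {V : C} {k : V ⊗ V ⟶ 𝟙_ C}

theorem br2_cupNest (hk : ∀ P, brL V V P ≫ cupL k P = cupL k P) (P : C) :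
    V ◁ brL V V (V ⊗ P) ≫ cupNest k P = cupNest k P := by
  rw [cupNest, ← whiskerLeft_comp_assoc, hk]

theorem br21_cupNest (P : C) :
    V ◁ brL V V (V ⊗ P) ≫ brL V V (V ⊗ V ⊗ P) ≫ cupNest k P = cupPair k P := by
  rw [cupPair, cupL_eq_brL, cupNest]
  simp

omit [BraidedCategory C] in
theorem cupPair_eq (P : C) : cupPair k P = V ◁ V ◁ cupL k P ≫ cupL k P := by
  rw [cupPair, cupL_natural]

theorem br32_cupPair (P : C) :
    V ◁ V ◁ brL V V P ≫ V ◁ brL V V (V ⊗ P) ≫ cupPair k P = cupNest k P := by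
  rw [cupNest, cupL_eq_brL, cupPair_eq]
  simp

end Pairings

/-! ### Braid symmetries of (x ∧ y)·(z ∧ u) -/

section Alternating

variable {C : Type u} [Category.{v} C] [MonoidalCategory C] [BraidedCategory C] [Preadditive C]

/-- The triple product `(x ∧ y) · z` is alternating, as seen on strands. -/
structure IsAlternating {V : C} (k : V ⊗ V ⟶ 𝟙_ C) (w : V ⊗ V ⟶ V) : Prop where
  symm (P : C) : brL V V P ≫ cupL k P = cupL k P
  asymm (P : C) : brL V V P ≫ opL w P = -opL w P
  assoc (P : C) : V ◁ opL w P ≫ cupL k P = opL w (V ⊗ P) ≫ cupL k P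

/-- The product `(x ∧ y) · (z ∧ u)`. -/
def wedgePair {V : C} (k : V ⊗ V ⟶ 𝟙_ C) (w : V ⊗ V ⟶ V) (P : C) : V ⊗ V ⊗ V ⊗ V ⊗ P ⟶ P :=
  opL w (V ⊗ V ⊗ P) ≫ V ◁ opL w P ≫ cupL k P

variable {V : C} {k : V ⊗ V ⟶ 𝟙_ C} {w : V ⊗ V ⟶ V} (h : IsAlternating k w)
include h

namespace IsAlternating

theorem br1_wedgePair (P : C) :
    brL V V (V ⊗ V ⊗ P) ≫ wedgePair k w P = -wedgePair k w P := by
  rw [wedgePair, reassoc_of% h.asymm, Preadditive.neg_comp]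

theorem wedgePair_eq (P : C) :
    wedgePair k w P = opL w (V ⊗ V ⊗ P) ≫ opL w (V ⊗ P) ≫ cupL k P := by
  rw [wedgePair, h.assoc]

/-- Symmetry of the inner product between the blocks x ∧ y and z ∧ u; crossing two blocks costs four
crossings of strands. -/
theorem wedgePair_swap (P : C) :
    V ◁ brL V V (V ⊗ P) ≫ brL V V (V ⊗ V ⊗ P) ≫ V ◁ V ◁ brL V V P ≫ V ◁ brL V V (V ⊗ P) ≫
      wedgePair k w P = wedgePair k w P := by
  have h₁ := congrArg (fun t => V ◁ t) (opL_brL w V P)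
  simp only [whiskerLeft_comp] at h₁
  conv_rhs => rw [wedgePair, ← h.symm, reassoc_of% whiskerLeft_opL_brL w V P,
    reassoc_of% opL_brL w V (V ⊗ P), reassoc_of% h₁, ← reassoc_of% opL_natural]
  rfl

/-- Here (y ∧ z)·(u ∧ x) = ((y ∧ z) ∧ u)·x = x·((y ∧ z) ∧ u) = (x ∧ (y ∧ z))·u, where the three
crossings carry x to the end. -/
theorem rot_wedgePair (P : C) :
    brL V V (V ⊗ V ⊗ P) ≫ V ◁ brL V V (V ⊗ P) ≫ V ◁ V ◁ brL V V P ≫ wedgePair k w P =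
      V ◁ opL w (V ⊗ P) ≫ opL w (V ⊗ P) ≫ cupL k P := by
  rw [← h.assoc, ← h.symm, reassoc_of% whiskerLeft_opL_brL w V P,
    reassoc_of% whiskerLeft_opL_brL w V (V ⊗ P), reassoc_of% opL_natural, h.wedgePair_eq]

variable [MonoidalPreadditive C]

theorem br2_triple (P : C) :
    V ◁ brL V V P ≫ opL w (V ⊗ P) ≫ cupL k P = -opL w (V ⊗ P) ≫ cupL k P := by
  rw [← h.assoc, ← whiskerLeft_comp_assoc, h.asymm, whiskerLeft_neg', Preadditive.neg_comp]

theorem br3_wedgePair (P : C) :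
    V ◁ V ◁ brL V V P ≫ wedgePair k w P = -wedgePair k w P := by
  rw [wedgePair, ← reassoc_of% opL_natural, ← whiskerLeft_comp_assoc, h.asymm, whiskerLeft_neg',
    Preadditive.neg_comp, Preadditive.comp_neg]

/-- Both sides pair x ∧ u with y ∧ z, in opposite orders and along different braids. In a symmetric
category this would be symmetry of the inner product alone; here anticommutativity is also needed,
in the form z ∧ (x ∧ y) = −(x ∧ y) ∧ z. -/
theorem br12_wedgePair (P : C) :
    brL V V (V ⊗ V ⊗ P) ≫ V ◁ brL V V (V ⊗ P) ≫ wedgePair k w P =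
      V ◁ V ◁ brL V V P ≫ V ◁ brL V V (V ⊗ P) ≫ wedgePair k w P := by
  -- By the block swap it remains to see that winding the third strand once around the first two has
  -- no effect.
  rw [← cancel_epi (brL V V (V ⊗ V ⊗ P)), ← cancel_epi (V ◁ brL V V (V ⊗ P)), h.wedgePair_swap]
  have h₁ := h.rot_wedgePair P
  rw [h.br3_wedgePair, Preadditive.comp_neg, Preadditive.comp_neg] at h₁
  rw [← neg_inj, ← Preadditive.comp_neg, ← Preadditive.comp_neg, h₁,
    ← reassoc_of% opL_brL w V (V ⊗ P), reassoc_of% h.asymm, Preadditive.neg_comp,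
    Preadditive.comp_neg, h.wedgePair_eq]

end IsAlternating

end Alternating

/-! ### The double wedge axiom as a quadrilinear identity -/

section VectorProduct

variable {C : Type u} [Category.{v} C] [MonoidalCategory C] [BraidedCategory C] [Preadditive C]
  [MonoidalPreadditive C] {V : C} {k : V ⊗ V ⟶ 𝟙_ C} {w : V ⊗ V ⟶ V}

/-- Cyclicity and anticommutativity make a crossing of the last two arguments of (x ∧ y)·z change
the sign. Moving x behind y and z in x·(y ∧ z) takes two crossings, whose signs cancel. -/
theorem IsVectorProductAlgebra.isAlternating (h : IsVectorProductAlgebra k w) :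
    IsAlternating k w where
  symm := (brL_cupL_iff k).1 h.selfDual.symm
  asymm := (brL_opL_iff w).1 h.asymm
  assoc P := by
    have hk := (brL_cupL_iff k).1 h.selfDual.symm
    have ha := (brL_opL_iff w).1 h.asymm
    have hc := (cyclic_iff k w).1 h.cyclic P
    rw [reassoc_of% ha, Preadditive.neg_comp, Preadditive.comp_neg] at hc
    rw [← hk, reassoc_of% whiskerLeft_opL_brL w V P, ← neg_eq_iff_eq_neg.2 hc,
      Preadditive.comp_neg, reassoc_of% ha, Preadditive.neg_comp, neg_neg, hk]

/-- `(x ∧ y) · (z ∧ u) + (y ∧ z) · (u ∧ x) = 2 (x · z) (y · u) - (x · y) (z · u) - (x · u) (y · z)` -/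
def QuadIdentity {V : C} (k : V ⊗ V ⟶ 𝟙_ C) (w : V ⊗ V ⟶ V) : Prop :=
  ∀ P, wedgePair k w P + brL V V (V ⊗ V ⊗ P) ≫ V ◁ brL V V (V ⊗ P) ≫
      V ◁ V ◁ brL V V P ≫ wedgePair k w P =
    (2 : ℤ) • (brL V V (V ⊗ V ⊗ P) ≫ cupNest k P) - cupPair k P - cupNest k P

/-- Pair the double wedge axiom with a fourth vector u and move u inside by associativity and
rotation of the triple product. -/
theorem IsVectorProductAlgebra.quadIdentity (h : IsVectorProductAlgebra k w) :
    QuadIdentity k w := by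
  intro P
  have ha := h.isAlternating
  have h₁ := congrArg (fun t => t ≫ cupL k P) ((wedge_wedge_iff k w).1 h.wedge_wedge (V ⊗ P))
  simp only [Preadditive.add_comp, Preadditive.sub_comp, Preadditive.zsmul_comp,
    Category.assoc] at h₁
  rw [ha.rot_wedgePair, ha.wedgePair_eq, h₁]
  rfl

-- Nondegeneracy on the output strand. Naturality in the spectators is what lets the copairing slide
-- back through F and G, so that they only occur followed by a cup.
omit [BraidedCategory C] [Preadditive C] [MonoidalPreadditive C] in
theorem IsCopairing.cancel_right {d : 𝟙_ C ⟶ V ⊗ V} (h : IsCopairing k d)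
    {F G : ∀ P, V ⊗ V ⊗ V ⊗ P ⟶ V ⊗ P}
    (hF : ∀ {P Q : C} (g : P ⟶ Q), F P ≫ V ◁ g = V ◁ V ◁ V ◁ g ≫ F Q)
    (hG : ∀ {P Q : C} (g : P ⟶ Q), G P ≫ V ◁ g = V ◁ V ◁ V ◁ g ≫ G Q)
    (hFG : ∀ P, F (V ⊗ P) ≫ cupL k P = G (V ⊗ P) ≫ cupL k P) (P : C) : F P = G P := by
  rw [← Category.comp_id (F P), ← Category.comp_id (G P), ← h.zag, reassoc_of% hF, reassoc_of% hG,
    hFG]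

theorem IsVectorProductAlgebra.of_quadIdentity (hd : IsDualityCounit k) (ha : IsAlternating k w)
    (hq : QuadIdentity k w) : IsVectorProductAlgebra k w where
  selfDual := ⟨hd, (brL_cupL_iff k).2 ha.symm⟩
  asymm := (brL_opL_iff w).2 ha.asymm
  cyclic := (cyclic_iff k w).2 fun P => by
    rw [reassoc_of% ha.asymm, Preadditive.neg_comp, Preadditive.comp_neg, ha.br2_triple,
      neg_neg]
  wedge_wedge := (wedge_wedge_iff k w).2 fun P => by
    obtain ⟨d, hd⟩ := hd.exists_copairing
    refine hd.cancel_right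
      (F := fun P => opL w (V ⊗ P) ≫ opL w P + V ◁ opL w P ≫ opL w P)
      (G := fun P => (2 : ℤ) • (brL V V (V ⊗ P) ≫ V ◁ cupL k P) - cupL k (V ⊗ P) - V ◁ cupL k P)
      ?_ ?_ ?_ P
    · intro P Q g
      simp only [Preadditive.add_comp, Preadditive.comp_add, Category.assoc, opL_natural]
      rw [reassoc_of% opL_natural, ← whiskerLeft_comp_assoc, opL_natural]
      simp
    · intro P Q g
      simp only [Preadditive.sub_comp, Preadditive.comp_sub, Preadditive.zsmul_comp,
        Preadditive.comp_zsmul, Category.assoc, ← whiskerLeft_comp, cupL_natural]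
      rw [← reassoc_of% brL_natural]
      simp
    · intro P
      simp only [Preadditive.add_comp, Preadditive.sub_comp, Preadditive.zsmul_comp,
        Category.assoc]
      have := hq P
      rw [ha.rot_wedgePair, ha.wedgePair_eq] at this
      rw [this]
      rfl

/-- Braiding the middle two strands is invertible and turns each side of one identity into the
other, up to moving terms across. -/
theorem IsAlternating.quadIdentity_iff (h : IsAlternating k w) :
    QuadIdentity k w ↔ ∀ P, V ◁ brL V V (V ⊗ P) ≫ (wedgePair k w P + cupPair k P) +
      V ◁ V ◁ brL V V P ≫ V ◁ brL V V (V ⊗ P) ≫ (wedgePair k w P + cupPair k P) =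
      (2 : ℤ) • cupPair k P := by
  refine forall_congr' fun P => ?_
  have yb := reassoc_of% yang_baxterL V V V (V ⊗ P)
  have hE3 := h.br3_wedgePair P
  have h12 := h.br12_wedgePair P
  have h32 := br32_cupPair (k := k) P
  have h21 := br21_cupNest (k := k) P
  have h2 := br2_cupNest h.symm P
  have c13 := reassoc_of% brL_natural V V (brL V V P)
  -- Yang–Baxter rewrites the crossings 2,1,2 as 1,2,1; the outer crossings 1 and 3 commute and are
  -- absorbed with two signs, leaving 1,2, which may be replaced by 3,2.
  have hE : V ◁ brL V V (V ⊗ P) ≫ brL V V (V ⊗ V ⊗ P) ≫ V ◁ brL V V (V ⊗ P) ≫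
      V ◁ V ◁ brL V V P ≫ wedgePair k w P =
      V ◁ V ◁ brL V V P ≫ V ◁ brL V V (V ⊗ P) ≫ wedgePair k w P := by
    rw [← yb, c13, h.br1_wedgePair, Preadditive.comp_neg, hE3, neg_neg, h12]
  rw [← cancel_epi (V ◁ brL V V (V ⊗ P))]
  simp only [Preadditive.comp_add, Preadditive.comp_sub, Preadditive.comp_zsmul, hE, h32, h21, h2]
  constructor
  · intro H
    rw [← sub_eq_zero] at H ⊢
    rw [← H]
    abel
  · intro H
    rw [← sub_eq_zero] at H ⊢
    rw [← H]
    abel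

end VectorProduct

/-! ### Inclusion of V into A on several strands -/

section Inclusion

variable {C : Type u} [Category.{v} C] [MonoidalCategory C]

/-- The inclusion of `V` into `A` on two strands. -/
def incl₂ {A V : C} (i : V ⟶ A) (P : C) : V ⊗ V ⊗ P ⟶ A ⊗ A ⊗ P := V ◁ i ▷ P ≫ i ▷ (A ⊗ P)

/-- The inclusion of `V` into `A` on three strands. -/
def incl₃ {A V : C} (i : V ⟶ A) (P : C) : V ⊗ V ⊗ V ⊗ P ⟶ A ⊗ A ⊗ A ⊗ P :=
  V ◁ incl₂ i P ≫ i ▷ (A ⊗ A ⊗ P)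

/-- The inclusion of `V` into `A` on four strands. -/
def incl₄ {A V : C} (i : V ⟶ A) (P : C) : V ⊗ V ⊗ V ⊗ V ⊗ P ⟶ A ⊗ A ⊗ A ⊗ A ⊗ P :=
  V ◁ incl₃ i P ≫ i ▷ (A ⊗ A ⊗ A ⊗ P)

variable {A V : C} (i : V ⟶ A)

theorem incl₂_natural {P Q : C} (g : P ⟶ Q) :
    incl₂ i P ≫ A ◁ A ◁ g = V ◁ V ◁ g ≫ incl₂ i Q := by
  rw [incl₂, Category.assoc, ← whisker_exchange, ← whiskerLeft_comp_assoc, ← whisker_exchange]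
  simp [incl₂]

theorem incl₃_eq (P : C) : incl₃ i P = V ◁ V ◁ i ▷ P ≫ incl₂ i (A ⊗ P) := by
  simp [incl₃, incl₂]

theorem incl₃_natural {P Q : C} (g : P ⟶ Q) :
    incl₃ i P ≫ A ◁ A ◁ A ◁ g = V ◁ V ◁ V ◁ g ≫ incl₃ i Q := by
  rw [incl₃, Category.assoc, ← whisker_exchange, ← whiskerLeft_comp_assoc, incl₂_natural]
  simp [incl₃]

theorem incl₄_eq (P : C) : incl₄ i P = V ◁ V ◁ incl₂ i P ≫ incl₂ i (A ⊗ A ⊗ P) := by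
  simp only [incl₄, incl₃, incl₂, whiskerLeft_comp, Category.assoc]

variable [BraidedCategory C]

theorem incl₂_br (P : C) : incl₂ i P ≫ brL A A P = brL V V P ≫ incl₂ i P := by
  rw [incl₂, Category.assoc, brL_left, reassoc_of% brL_right, whisker_exchange]

theorem incl₃_br1 (P : C) : incl₃ i P ≫ brL A A (A ⊗ P) = brL V V (V ⊗ P) ≫ incl₃ i P := by
  rw [incl₃_eq, Category.assoc, incl₂_br, reassoc_of% brL_natural]

theorem incl₃_br2 (P : C) : incl₃ i P ≫ A ◁ brL A A P = V ◁ brL V V P ≫ incl₃ i P := by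
  rw [incl₃, Category.assoc, ← whisker_exchange, ← whiskerLeft_comp_assoc, incl₂_br,
    whiskerLeft_comp_assoc]

theorem incl₄_br2 (P : C) :
    incl₄ i P ≫ A ◁ brL A A (A ⊗ P) = V ◁ brL V V (V ⊗ P) ≫ incl₄ i P := by
  rw [incl₄, Category.assoc, ← whisker_exchange, ← whiskerLeft_comp_assoc, incl₃_br1,
    whiskerLeft_comp_assoc]

theorem incl₄_br3 (P : C) :
    incl₄ i P ≫ A ◁ A ◁ brL A A P = V ◁ V ◁ brL V V P ≫ incl₄ i P := by
  rw [incl₄, Category.assoc, ← whisker_exchange, ← whiskerLeft_comp_assoc, incl₃_br2,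
    whiskerLeft_comp_assoc]

end Inclusion

/-! ### Checking identities on the blocks of A = I ⊕ V -/

section Split

variable {C : Type u} [Category.{v} C] [MonoidalCategory C] [Preadditive C]

/-- `A` is the direct sum of the tensor unit and `V`. -/
structure IsUnitSum {A V : C} (e : 𝟙_ C ⟶ A) (p : A ⟶ 𝟙_ C) (i : V ⟶ A) (q : A ⟶ V) : Prop where
  e_p : e ≫ p = 𝟙 _
  e_q : e ≫ q = 0
  i_p : i ≫ p = 0
  i_q : i ≫ q = 𝟙 _
  total : p ≫ e + q ≫ i = 𝟙 A

variable [MonoidalPreadditive C] {A V : C} {e : 𝟙_ C ⟶ A} {p : A ⟶ 𝟙_ C} {i : V ⟶ A} {q : A ⟶ V}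

omit [MonoidalCategory C] [MonoidalPreadditive C] in
theorem hom_ext_of_decomposition {R S S' Q : C} {a : R ⟶ S} {b : S ⟶ R} {c : R ⟶ S'} {d : S' ⟶ R}
    (h : a ≫ b + c ≫ d = 𝟙 R) {f g : R ⟶ Q} (hb : b ≫ f = b ≫ g) (hd : d ≫ f = d ≫ g) :
    f = g := by
  rw [← Category.id_comp f, ← Category.id_comp g, ← h, Preadditive.add_comp, Preadditive.add_comp]
  simp only [Category.assoc, hb, hd]

omit [Preadditive C] [MonoidalPreadditive C] in
theorem formL_ptL (p : A ⟶ 𝟙_ C) (e : 𝟙_ C ⟶ A) (P : C) : formL p P ≫ ptL e P = (p ≫ e) ▷ P := by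
  simp [formL, ptL]

theorem decomposition_whiskerLeft {R S S' : C} {a : R ⟶ S} {b : S ⟶ R} {c : R ⟶ S'} {d : S' ⟶ R}
    (h : a ≫ b + c ≫ d = 𝟙 R) (X : C) :
    X ◁ a ≫ X ◁ b + X ◁ c ≫ X ◁ d = 𝟙 (X ⊗ R) := by
  rw [← whiskerLeft_comp, ← whiskerLeft_comp, ← MonoidalPreadditive.whiskerLeft_add, h,
    whiskerLeft_id]

namespace IsUnitSum

variable (h : IsUnitSum e p i q)
include h

theorem decomposition (P : C) : formL p P ≫ ptL e P + q ▷ P ≫ i ▷ P = 𝟙 (A ⊗ P) := by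
  rw [formL_ptL, ← comp_whiskerRight, ← MonoidalPreadditive.add_whiskerRight, h.total,
    id_whiskerRight]

theorem ext_one {P Q : C} {f g : A ⊗ P ⟶ Q} (h₁ : ptL e P ≫ f = ptL e P ≫ g)
    (h₀ : i ▷ P ≫ f = i ▷ P ≫ g) : f = g :=
  hom_ext_of_decomposition (h.decomposition P) h₁ h₀

/-- The cases overlap on purpose: where e fills one slot the others still range over A, so just one
further case, with every slot in V, is needed. -/
theorem ext_two {P Q : C} {f g : A ⊗ A ⊗ P ⟶ Q}
    (h₁ : ptL e _ ≫ f = ptL e _ ≫ g) (h₂ : A ◁ ptL e _ ≫ f = A ◁ ptL e _ ≫ g)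
    (h₀ : incl₂ i P ≫ f = incl₂ i P ≫ g) : f = g := by
  simp only [incl₂, Category.assoc] at h₀
  refine h.ext_one h₁ (hom_ext_of_decomposition
    (decomposition_whiskerLeft (h.decomposition P) V) ?_ h₀)
  rw [whisker_exchange_assoc, whisker_exchange_assoc, h₂]

theorem ext_three {P Q : C} {f g : A ⊗ A ⊗ A ⊗ P ⟶ Q}
    (h₁ : ptL e _ ≫ f = ptL e _ ≫ g) (h₂ : A ◁ ptL e _ ≫ f = A ◁ ptL e _ ≫ g)
    (h₃ : A ◁ A ◁ ptL e _ ≫ f = A ◁ A ◁ ptL e _ ≫ g)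
    (h₀ : incl₃ i P ≫ f = incl₃ i P ≫ g) : f = g := by
  simp only [incl₃_eq, Category.assoc] at h₀
  refine h.ext_two h₁ h₂ (hom_ext_of_decomposition
    (decomposition_whiskerLeft (decomposition_whiskerLeft (h.decomposition P) V) V) ?_ h₀)
  rw [← reassoc_of% incl₂_natural, ← reassoc_of% incl₂_natural, h₃]

theorem ext_four {P Q : C} {f g : A ⊗ A ⊗ A ⊗ A ⊗ P ⟶ Q}
    (h₁ : ptL e _ ≫ f = ptL e _ ≫ g) (h₂ : A ◁ ptL e _ ≫ f = A ◁ ptL e _ ≫ g)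
    (h₃ : A ◁ A ◁ ptL e _ ≫ f = A ◁ A ◁ ptL e _ ≫ g)
    (h₄ : A ◁ A ◁ A ◁ ptL e _ ≫ f = A ◁ A ◁ A ◁ ptL e _ ≫ g)
    (h₀ : incl₄ i P ≫ f = incl₄ i P ≫ g) : f = g := by
  have h₅ : incl₄ i P = V ◁ V ◁ V ◁ i ▷ P ≫ incl₃ i (A ⊗ P) := by
    simp only [incl₄, incl₃, incl₂, whiskerLeft_comp, Category.assoc]
  simp only [h₅, Category.assoc] at h₀
  refine h.ext_three h₁ h₂ h₃ (hom_ext_of_decomposition (decomposition_whiskerLeft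
    (decomposition_whiskerLeft (decomposition_whiskerLeft (h.decomposition P) V) V) V) ?_ h₀)
  rw [← reassoc_of% incl₃_natural, ← reassoc_of% incl₃_natural, h₄]

end IsUnitSum

end Split

/-! ### Unital multiplications and triple products with an argument equal to e -/

section Unital

variable {C : Type u} [Category.{v} C] [MonoidalCategory C] [BraidedCategory C]

/-- A unital multiplication with a symmetric pairing, as seen on strands. -/
structure IsUnital {A : C} (k : A ⊗ A ⟶ 𝟙_ C) (m : A ⊗ A ⟶ A) (e : 𝟙_ C ⟶ A) (p : A ⟶ 𝟙_ C) :
    Prop where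
  symm (P : C) : brL A A P ≫ cupL k P = cupL k P
  one_mul (P : C) : ptL e (A ⊗ P) ≫ opL m P = 𝟙 _
  mul_one (P : C) : A ◁ ptL e P ≫ opL m P = 𝟙 _
  cup_one (P : C) : A ◁ ptL e P ≫ cupL k P = formL p P
  one_form (P : C) : ptL e P ≫ formL p P = 𝟙 _

/-- The triple product `(x y) · z`. -/
def tripleLeft {A : C} (k : A ⊗ A ⟶ 𝟙_ C) (m : A ⊗ A ⟶ A) (P : C) : A ⊗ A ⊗ A ⊗ P ⟶ P :=
  opL m (A ⊗ P) ≫ cupL k P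

/-- The triple product `x · (y z)`. -/
def tripleRight {A : C} (k : A ⊗ A ⟶ 𝟙_ C) (m : A ⊗ A ⟶ A) (P : C) : A ⊗ A ⊗ A ⊗ P ⟶ P :=
  A ◁ opL m P ≫ cupL k P

variable {A : C} {k : A ⊗ A ⟶ 𝟙_ C} {m : A ⊗ A ⟶ A} {e : 𝟙_ C ⟶ A} {p : A ⟶ 𝟙_ C}

namespace IsUnital

variable (h : IsUnital k m e p)
include h

theorem one_cup (P : C) : ptL e (A ⊗ P) ≫ cupL k P = formL p P := by
  rw [← h.symm, reassoc_of% ptL_brL, h.cup_one]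

theorem tripleLeft_eq (P : C) :
    tripleLeft k m P = A ◁ brL A A P ≫ brL A A (A ⊗ P) ≫ tripleRight k m P := by
  rw [tripleLeft, ← h.symm, reassoc_of% opL_brL, tripleRight]

theorem pt1_tripleLeft (P : C) : ptL e (A ⊗ A ⊗ P) ≫ tripleLeft k m P = cupL k P := by
  rw [tripleLeft, reassoc_of% h.one_mul]

theorem pt2_tripleLeft (P : C) : A ◁ ptL e (A ⊗ P) ≫ tripleLeft k m P = cupL k P := by
  rw [tripleLeft, reassoc_of% h.mul_one]

theorem pt3_tripleLeft (P : C) :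
    A ◁ A ◁ ptL e P ≫ tripleLeft k m P = opL m P ≫ formL p P := by
  rw [tripleLeft, ← reassoc_of% opL_natural, h.cup_one]

theorem pt1_tripleRight (P : C) :
    ptL e (A ⊗ A ⊗ P) ≫ tripleRight k m P = opL m P ≫ formL p P := by
  rw [tripleRight, ← reassoc_of% ptL_natural, h.one_cup]

theorem pt2_tripleRight (P : C) : A ◁ ptL e (A ⊗ P) ≫ tripleRight k m P = cupL k P := by
  rw [tripleRight, ← whiskerLeft_comp_assoc, h.one_mul]
  simp

theorem pt3_tripleRight (P : C) : A ◁ A ◁ ptL e P ≫ tripleRight k m P = cupL k P := by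
  rw [tripleRight, ← whiskerLeft_comp_assoc, h.mul_one]
  simp

theorem pt1_cupPair (P : C) : ptL e _ ≫ cupPair k P = formL p _ ≫ cupL k P := by
  rw [cupPair, reassoc_of% h.one_cup]

theorem pt2_cupPair (P : C) : A ◁ ptL e _ ≫ cupPair k P = formL p _ ≫ cupL k P := by
  rw [cupPair, reassoc_of% h.cup_one]

theorem pt3_cupPair (P : C) : A ◁ A ◁ ptL e _ ≫ cupPair k P = cupL k _ ≫ formL p P := by
  rw [cupPair, ← reassoc_of% cupL_natural, h.one_cup]

theorem pt4_cupPair (P : C) : A ◁ A ◁ A ◁ ptL e _ ≫ cupPair k P = cupL k _ ≫ formL p P := by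
  rw [cupPair, ← reassoc_of% cupL_natural, h.cup_one]

end IsUnital

end Unital

/-! ### The composition law with one argument equal to e -/

section Composition

variable {C : Type u} [Category.{v} C] [MonoidalCategory C] [BraidedCategory C] [Preadditive C]

/-- The left side `(x z) · (y w) + (x w) · (y z)` of the composition law. -/
def compSum {A : C} (k : A ⊗ A ⟶ 𝟙_ C) (m : A ⊗ A ⟶ A) (P : C) : A ⊗ A ⊗ A ⊗ A ⊗ P ⟶ P :=
  A ◁ brL A A (A ⊗ P) ≫ opL m (A ⊗ A ⊗ P) ≫ A ◁ opL m P ≫ cupL k P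
      + A ◁ A ◁ brL A A P ≫ A ◁ brL A A (A ⊗ P) ≫ opL m (A ⊗ A ⊗ P) ≫ A ◁ opL m P ≫ cupL k P

variable {A : C} {k : A ⊗ A ⟶ 𝟙_ C} {m : A ⊗ A ⟶ A} {e : 𝟙_ C ⟶ A} {p : A ⟶ 𝟙_ C}

namespace IsUnital

variable (h : IsUnital k m e p)
include h

/-- One product loses its multiplication in each term, so triple products remain. The third and
fourth slots give the same expression, since e crosses any strand trivially. -/
theorem pt1_compSum (P : C) : ptL e _ ≫ compSum k m P =
    brL A A (A ⊗ P) ≫ tripleRight k m P + tripleLeft k m P := by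
  rw [compSum, Preadditive.comp_add, h.tripleLeft_eq]
  congr 1
  · rw [← reassoc_of% ptL_natural, reassoc_of% h.one_mul, tripleRight]
  · rw [← reassoc_of% ptL_natural, ← reassoc_of% ptL_natural, reassoc_of% h.one_mul, tripleRight]

theorem pt2_compSum (P : C) : A ◁ ptL e _ ≫ compSum k m P =
    tripleLeft k m P + A ◁ brL A A P ≫ tripleLeft k m P := by
  rw [compSum, Preadditive.comp_add]
  have h₁ : A ◁ ptL e (A ⊗ A ⊗ P) ≫ A ◁ brL A A (A ⊗ P) ≫ opL m (A ⊗ A ⊗ P) ≫ A ◁ opL m P ≫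
      cupL k P = tripleLeft k m P := by
    rw [← whiskerLeft_comp_assoc, ptL_brL, ← reassoc_of% opL_natural,
      ← whiskerLeft_comp_assoc, h.one_mul, tripleLeft]
    simp
  congr 1
  conv_lhs => rw [← whiskerLeft_comp_assoc, ← ptL_natural, whiskerLeft_comp_assoc, h₁]

theorem pt3_compSum (P : C) : A ◁ A ◁ ptL e _ ≫ compSum k m P =
    tripleRight k m P + A ◁ brL A A P ≫ tripleLeft k m P := by
  rw [compSum, Preadditive.comp_add]
  congr 1
  · rw [← whiskerLeft_comp_assoc, whiskerLeft_ptL_brL, reassoc_of% h.mul_one, tripleRight]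
  · rw [← whiskerLeft_comp_assoc, ← whiskerLeft_comp, ptL_brL, ← whiskerLeft_comp_assoc,
      ← brL_natural, whiskerLeft_comp_assoc, ← reassoc_of% opL_natural, ← whiskerLeft_comp_assoc,
      h.mul_one, tripleLeft]
    simp

theorem pt4_compSum (P : C) : A ◁ A ◁ A ◁ ptL e _ ≫ compSum k m P =
    tripleRight k m P + A ◁ brL A A P ≫ tripleLeft k m P := by
  rw [compSum, Preadditive.comp_add, add_comm]
  congr 1
  · rw [← whiskerLeft_comp_assoc, ← whiskerLeft_comp, whiskerLeft_ptL_brL, ← whiskerLeft_comp_assoc,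
      whiskerLeft_ptL_brL, reassoc_of% h.mul_one, tripleRight]
  · rw [← whiskerLeft_comp_assoc, ← brL_natural, whiskerLeft_comp_assoc, ← reassoc_of% opL_natural,
      ← whiskerLeft_comp_assoc, h.mul_one, tripleLeft]
    simp

end IsUnital

end Composition

/-! ### From the quadrilinear identity on V to the composition law on A -/

section SplitUnital

variable {C : Type u} [Category.{v} C] [MonoidalCategory C] [BraidedCategory C] [Preadditive C]

/-- A unital multiplication on `A = I ⊕ V` and a symmetric pairing for which the summands are
orthogonal. -/
structure IsSplitUnital {A V : C} (k : A ⊗ A ⟶ 𝟙_ C) (m : A ⊗ A ⟶ A) (e : 𝟙_ C ⟶ A) (p : A ⟶ 𝟙_ C)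
    (i : V ⟶ A) (q : A ⟶ V) (kV : V ⊗ V ⟶ 𝟙_ C) : Prop extends
    IsUnital k m e p, IsUnitSum e p i q where
  cup_incl (P : C) : incl₂ i P ≫ cupL k P = cupL kV P

variable {A V : C} {k : A ⊗ A ⟶ 𝟙_ C} {m : A ⊗ A ⟶ A} {e : 𝟙_ C ⟶ A} {p : A ⟶ 𝟙_ C}
  {i : V ⟶ A} {q : A ⟶ V} {kV : V ⊗ V ⟶ 𝟙_ C} {w : V ⊗ V ⟶ V}

namespace IsSplitUnital

variable (h : IsSplitUnital k m e p i q kV)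
include h

theorem symmV (P : C) : brL V V P ≫ cupL kV P = cupL kV P := by
  rw [← h.cup_incl, ← reassoc_of% incl₂_br, h.symm]

theorem incl_cupPair (P : C) : incl₄ i P ≫ cupPair k P = cupPair kV P := by
  rw [incl₄_eq, cupPair, Category.assoc, reassoc_of% h.cup_incl, ← reassoc_of% cupL_natural,
    h.cup_incl, cupPair]

theorem incl_proj (P : C) : i ▷ P ≫ q ▷ P = 𝟙 _ := by
  rw [← comp_whiskerRight, h.i_q, id_whiskerRight]

variable [MonoidalPreadditive C]

theorem incl_form (P : C) : i ▷ P ≫ formL p P = 0 := by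
  rw [formL, ← comp_whiskerRight_assoc, h.i_p]
  simp

theorem incl_cup_one (P : C) : V ◁ ptL e P ≫ i ▷ (A ⊗ P) ≫ cupL k P = 0 := by
  rw [whisker_exchange_assoc, h.cup_one, h.incl_form]

/-- Since V is orthogonal to e, only the V-component of the second argument is seen. -/
theorem proj_right_cup (P : C) : V ◁ q ▷ P ≫ cupL kV P = i ▷ (A ⊗ P) ≫ cupL k P := by
  have h₁ : q ▷ P ≫ i ▷ P = 𝟙 _ - formL p P ≫ ptL e P := by
    rw [← h.decomposition P]; abel
  rw [← h.cup_incl, incl₂, Category.assoc, ← whiskerLeft_comp_assoc, h₁, whiskerLeft_sub',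
    Preadditive.sub_comp, whiskerLeft_comp_assoc, h.incl_cup_one]
  simp

theorem proj_left_cup (P : C) : q ▷ (V ⊗ P) ≫ cupL kV P = A ◁ i ▷ P ≫ cupL k P := by
  rw [← h.symmV, reassoc_of% brL_left, h.proj_right_cup, ← h.symm P, reassoc_of% brL_right, h.symm]

/-- Orthogonality turns q into the adjoint of i, so each zigzag on V becomes the zigzag on A between
i and q. -/
theorem isCopairing_proj {d : 𝟙_ C ⟶ A ⊗ A} (hd : IsCopairing k d) :
    IsCopairing kV (d ≫ (q ⊗ₘ q)) := by
  have hc (P : C) : copL (d ≫ (q ⊗ₘ q)) P = copL d P ≫ q ▷ (A ⊗ P) ≫ V ◁ q ▷ P := by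
    simp [copL, MonoidalCategory.tensorHom_def]
  constructor
  · intro P
    rw [hc, Category.assoc, Category.assoc, ← whiskerLeft_comp, h.proj_left_cup,
      whiskerLeft_comp, ← whisker_exchange_assoc, ← whisker_exchange, ← reassoc_of% copL_natural d,
      reassoc_of% hd.zig, h.incl_proj]
  · intro P
    rw [hc]
    simp only [whiskerLeft_comp, Category.assoc]
    rw [← cupL_natural, reassoc_of% h.proj_right_cup, whisker_exchange_assoc, reassoc_of% hd.zag,
      h.incl_proj]

/-- An orthogonal sum has the sum of the copairings; the two zigzags yield the two summands of the
identity of A. -/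
theorem isCopairing_incl {d : 𝟙_ C ⟶ V ⊗ V} (hd : IsCopairing kV d) :
    IsCopairing k ((λ_ _).inv ≫ (e ⊗ₘ e) + d ≫ (i ⊗ₘ i)) := by
  have hc (P : C) : copL ((λ_ _).inv ≫ (e ⊗ₘ e) + d ≫ (i ⊗ₘ i)) P =
      ptL e P ≫ ptL e (A ⊗ P) + copL d P ≫ incl₂ i P := by
    have h₁ : copL ((λ_ _).inv ≫ (e ⊗ₘ e)) P = ptL e P ≫ ptL e (A ⊗ P) := by
      simp only [copL, ptL, MonoidalCategory.tensorHom_def']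
      monoidal
    have h₂ : copL (d ≫ (i ⊗ₘ i)) P = copL d P ≫ incl₂ i P := by
      simp [copL, incl₂, MonoidalCategory.tensorHom_def']
    rw [← h₁, ← h₂]
    simp [copL]
  constructor
  · intro P
    rw [hc, ← h.decomposition, Preadditive.add_comp]
    congr 1
    · rw [Category.assoc, ← ptL_natural, reassoc_of% h.one_cup]
    · rw [incl₂, Category.assoc, Category.assoc, ← whisker_exchange, ← whiskerLeft_comp_assoc,
        ← h.proj_right_cup, whiskerLeft_comp_assoc, ← reassoc_of% copL_natural d,
        reassoc_of% hd.zig]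
  · intro P
    rw [hc, ← h.decomposition, MonoidalPreadditive.whiskerLeft_add, Preadditive.add_comp]
    congr 1
    · rw [whiskerLeft_comp, Category.assoc, h.cup_one, formL_natural]
    · rw [incl₂]
      simp only [whiskerLeft_comp, Category.assoc]
      rw [← h.proj_left_cup, whisker_exchange_assoc, whisker_exchange_assoc, ← cupL_natural,
        reassoc_of% hd.zag]

end IsSplitUnital

/-- The multiplication is `x y = x ∧ y - (x · y) e` on `V`. -/
def MulIncl (m : A ⊗ A ⟶ A) (e : 𝟙_ C ⟶ A) (i : V ⟶ A) (kV : V ⊗ V ⟶ 𝟙_ C) (w : V ⊗ V ⟶ V) : Prop :=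
  ∀ P, incl₂ i P ≫ opL m P = opL w P ≫ i ▷ P - cupL kV P ≫ ptL e P

namespace IsSplitUnital

variable [MonoidalPreadditive C] (h : IsSplitUnital k m e p i q kV) (hm : MulIncl m e i kV w)
include h hm

theorem incl_mul_form (P : C) : incl₂ i P ≫ opL m P ≫ formL p P = -cupL kV P := by
  rw [reassoc_of% hm, Preadditive.sub_comp, Category.assoc, h.incl_form, Category.assoc,
    h.one_form]
  simp

theorem incl_tripleRight (P : C) :
    incl₃ i P ≫ tripleRight k m P = V ◁ opL w P ≫ cupL kV P := by
  rw [incl₃, tripleRight, Category.assoc, ← whisker_exchange_assoc, ← whiskerLeft_comp_assoc,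
    hm, whiskerLeft_sub', Preadditive.sub_comp, whiskerLeft_comp_assoc, whiskerLeft_comp_assoc,
    h.incl_cup_one, ← h.cup_incl, incl₂]
  simp

theorem incl_tripleLeft (P : C) :
    incl₃ i P ≫ tripleLeft k m P = opL w (V ⊗ P) ≫ cupL kV P := by
  rw [incl₃_eq, tripleLeft, Category.assoc, reassoc_of% hm, Preadditive.sub_comp,
    Preadditive.comp_sub, Category.assoc, Category.assoc, h.one_cup, ← reassoc_of% cupL_natural,
    h.incl_form, ← reassoc_of% opL_natural, comp_zero, sub_zero,
    ← h.cup_incl P, incl₂, Category.assoc]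

/-- Expand (x ∧ y − (x·y)e)·(z ∧ u − (z·u)e): the mixed terms vanish by orthogonality and e·e = 1.
-/
theorem incl_wedgePair (P : C) :
    incl₄ i P ≫ wedgePair k m P = wedgePair kV w P + cupPair kV P := by
  have h₁ := h.incl_tripleRight hm P
  rw [incl₃, tripleRight, Category.assoc] at h₁
  have h₂ := h.pt1_tripleRight P
  rw [tripleRight] at h₂
  rw [incl₄_eq, wedgePair, Category.assoc, reassoc_of% hm, Preadditive.sub_comp,
    Preadditive.comp_sub, Category.assoc, Category.assoc, h₂, ← reassoc_of% cupL_natural,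
    h.incl_mul_form hm, ← reassoc_of% opL_natural, h₁, wedgePair, cupPair]
  simp

theorem incl_compSum (P : C) :
    incl₄ i P ≫ compSum k m P =
      V ◁ brL V V (V ⊗ P) ≫ (wedgePair kV w P + cupPair kV P) +
      V ◁ V ◁ brL V V P ≫ V ◁ brL V V (V ⊗ P) ≫ (wedgePair kV w P + cupPair kV P) := by
  rw [← h.incl_wedgePair hm, ← reassoc_of% incl₄_br2, ← reassoc_of% incl₄_br3, compSum,
    Preadditive.comp_add]
  rfl

/-- For a + x and b + y both sides are ab − x·y. This supplies the bilinear cases of the composition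
law, with two arguments equal to e. -/
theorem mul_form (P : C) :
    opL m P ≫ formL p P = (2 : ℤ) • (formL p (A ⊗ P) ≫ formL p P) - cupL k P := by
  refine h.ext_two ?_ ?_ ?_ <;> simp only [Preadditive.comp_sub, Preadditive.comp_zsmul]
  · rw [reassoc_of% h.one_mul, reassoc_of% h.one_form, h.one_cup]
    abel
  · rw [reassoc_of% h.mul_one, ← reassoc_of% formL_natural, h.one_form, h.cup_one, Category.comp_id]
    abel
  · rw [h.incl_mul_form hm, h.cup_incl, incl₂, Category.assoc, reassoc_of% h.incl_form]
    simp

theorem composition_of_quadIdentity (ha : IsAlternating kV w) (hq : QuadIdentity kV w) (P : C) :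
    compSum k m P = (2 : ℤ) • cupPair k P := by
  have hmf := h.mul_form hm P
  have hsymm := h.symm
  have hI : incl₃ i P ≫ formL p (A ⊗ A ⊗ P) = 0 := by
    rw [incl₃, Category.assoc, h.incl_form, comp_zero]
  -- The identities `h₁`, `h₂`, `h₃` are the composition law with e in the first, second, and third
  -- or fourth slot. A further e reduces them to symmetry and `mul_form`; on V the right sides
  -- vanish and the left sides cancel by alternation.
  have h₁ : brL A A (A ⊗ P) ≫ tripleRight k m P + tripleLeft k m P =
      (2 : ℤ) • (formL p (A ⊗ A ⊗ P) ≫ cupL k P) := by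
    refine h.ext_three ?_ ?_ ?_ ?_ <;> simp only [Preadditive.comp_add, Preadditive.comp_zsmul]
    · rw [reassoc_of% ptL_brL, h.pt2_tripleRight, h.pt1_tripleLeft, reassoc_of% h.one_form]
      abel
    · rw [reassoc_of% whiskerLeft_ptL_brL, h.pt1_tripleRight, h.pt2_tripleLeft,
        ← reassoc_of% formL_natural, h.one_cup, hmf]
      abel
    · rw [← reassoc_of% brL_natural, h.pt3_tripleRight, h.pt3_tripleLeft,
        ← reassoc_of% formL_natural, h.cup_one, hmf, hsymm]
      abel
    · rw [reassoc_of% incl₃_br1, h.incl_tripleRight hm, h.incl_tripleLeft hm, ha.assoc,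
        reassoc_of% ha.asymm, reassoc_of% hI]
      simp
  have h₂ : tripleLeft k m P + A ◁ brL A A P ≫ tripleLeft k m P =
      (2 : ℤ) • (formL p (A ⊗ A ⊗ P) ≫ cupL k P) := by
    refine h.ext_three ?_ ?_ ?_ ?_ <;> simp only [Preadditive.comp_add, Preadditive.comp_zsmul]
    · rw [← reassoc_of% ptL_natural, h.pt1_tripleLeft, hsymm, reassoc_of% h.one_form]
      abel
    · rw [h.pt2_tripleLeft, ← whiskerLeft_comp_assoc, ptL_brL, h.pt3_tripleLeft, hmf,
        ← reassoc_of% formL_natural, h.one_cup]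
      abel
    · rw [h.pt3_tripleLeft, ← whiskerLeft_comp_assoc, whiskerLeft_ptL_brL, h.pt2_tripleLeft, hmf,
        ← reassoc_of% formL_natural, h.cup_one]
      abel
    · rw [reassoc_of% incl₃_br2, h.incl_tripleLeft hm, ha.br2_triple, reassoc_of% hI]
      simp
  have h₃ : tripleRight k m P + A ◁ brL A A P ≫ tripleLeft k m P =
      (2 : ℤ) • (cupL k (A ⊗ P) ≫ formL p P) := by
    refine h.ext_three ?_ ?_ ?_ ?_ <;> simp only [Preadditive.comp_add, Preadditive.comp_zsmul]
    · rw [h.pt1_tripleRight, ← reassoc_of% ptL_natural, h.pt1_tripleLeft, hsymm, hmf,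
        reassoc_of% h.one_cup]
      abel
    · rw [h.pt2_tripleRight, ← whiskerLeft_comp_assoc, ptL_brL, h.pt3_tripleLeft, hmf,
        reassoc_of% h.cup_one]
      abel
    · rw [h.pt3_tripleRight, ← whiskerLeft_comp_assoc, whiskerLeft_ptL_brL, h.pt2_tripleLeft,
        ← reassoc_of% cupL_natural, h.one_form, Category.comp_id]
      abel
    · rw [h.incl_tripleRight hm, reassoc_of% incl₃_br2, h.incl_tripleLeft hm, ha.br2_triple,
        ha.assoc, incl₃_eq, Category.assoc, reassoc_of% h.cup_incl, ← reassoc_of% cupL_natural,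
        h.incl_form]
      simp
  refine h.ext_four ?_ ?_ ?_ ?_ ?_ <;> rw [Preadditive.comp_zsmul]
  · rw [h.pt1_compSum, h.pt1_cupPair, h₁]
  · rw [h.pt2_compSum, h.pt2_cupPair, h₂]
  · rw [h.pt3_compSum, h.pt3_cupPair, h₃]
  · rw [h.pt4_compSum, h.pt4_cupPair, h₃]
  · rw [h.incl_compSum hm, h.incl_cupPair, ha.quadIdentity_iff.1 hq]

theorem braid_braid_mul (ha : IsAlternating kV w) (P : C) :
    brL A A P ≫ brL A A P ≫ opL m P = opL m P := by
  refine h.ext_two ?_ ?_ ?_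
  · rw [reassoc_of% ptL_brL, reassoc_of% whiskerLeft_ptL_brL]
  · rw [reassoc_of% whiskerLeft_ptL_brL, reassoc_of% ptL_brL]
  · rw [reassoc_of% incl₂_br, reassoc_of% incl₂_br, hm]
    simp only [Preadditive.comp_sub, reassoc_of% ha.symm, reassoc_of% ha.asymm,
      Preadditive.neg_comp, Preadditive.comp_neg, neg_neg]

end IsSplitUnital

end SplitUnital

/-! ### From the composition law on A to the vector product on V -/

section Complement

variable {C : Type u} [Category.{v} C] [MonoidalCategory C] [BraidedCategory C] [Preadditive C]
  {A V : C} {k : A ⊗ A ⟶ 𝟙_ C} {m : A ⊗ A ⟶ A} {e : 𝟙_ C ⟶ A} {p : A ⟶ 𝟙_ C}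
  {i : V ⟶ A} {q : A ⟶ V} {kV : V ⊗ V ⟶ 𝟙_ C} {w : V ⊗ V ⟶ V}

/-- This is the composition law with first and last arguments equal to e. -/
theorem IsUnital.mul_form_of_composition (h : IsUnital k m e p)
    (hc : ∀ P, compSum k m P = (2 : ℤ) • cupPair k P) (P : C) :
    opL m P ≫ formL p P = (2 : ℤ) • (formL p (A ⊗ P) ≫ formL p P) - cupL k P := by
  have h₁ := congrArg (fun t => A ◁ A ◁ ptL e P ≫ ptL e (A ⊗ A ⊗ A ⊗ P) ≫ t) (hc P)
  simp only [h.pt1_compSum, Preadditive.comp_zsmul, h.pt1_cupPair, Preadditive.comp_add,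
    h.pt3_tripleLeft] at h₁
  rw [← reassoc_of% brL_natural, h.pt3_tripleRight, h.symm, ← reassoc_of% formL_natural, h.cup_one]
    at h₁
  rw [← h₁]
  abel

namespace IsSplitUnital

variable [MonoidalPreadditive C] (h : IsSplitUnital k m e p i q kV)
  (hc : ∀ P, compSum k m P = (2 : ℤ) • cupPair k P)
include h hc

theorem incl_mul_form_of_composition (P : C) :
    incl₂ i P ≫ opL m P ≫ formL p P = -cupL kV P := by
  rw [h.mul_form_of_composition hc, Preadditive.comp_sub, h.cup_incl, Preadditive.comp_zsmul, incl₂,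
    Category.assoc, reassoc_of% h.incl_form]
  simp

/-- With e in the first slot the law gives z·(xy) = −(xz)·y up to braiding, with e in the third
x·(yz) = −(xz)·y, the right sides vanishing on V. Crossing strands in the first relation makes
(xy)·z antisymmetric in y and z, and the second then gives associativity. -/
theorem incl_triple_of_composition (P : C) :
    incl₃ i P ≫ tripleLeft k m P = incl₃ i P ≫ tripleRight k m P ∧
    V ◁ brL V V P ≫ incl₃ i P ≫ tripleRight k m P = -(incl₃ i P ≫ tripleRight k m P) := by
  have hI : incl₃ i P ≫ formL p (A ⊗ A ⊗ P) = 0 := by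
    rw [incl₃, Category.assoc, h.incl_form, comp_zero]
  have h₁ := congrArg (fun t => incl₃ i P ≫ ptL e (A ⊗ A ⊗ A ⊗ P) ≫ t) (hc P)
  have h₃ := congrArg (fun t => incl₃ i P ≫ A ◁ A ◁ ptL e (A ⊗ P) ≫ t) (hc P)
  simp only [h.pt1_compSum, h.pt3_compSum, Preadditive.comp_zsmul, h.pt1_cupPair, h.pt3_cupPair,
    Preadditive.comp_add, reassoc_of% hI, zero_comp, smul_zero] at h₁ h₃
  rw [incl₃_eq i P, Category.assoc _ _ (cupL k _ ≫ _), reassoc_of% h.cup_incl,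
    ← reassoc_of% cupL_natural, h.incl_form, comp_zero, smul_zero, ← incl₃_eq,
    reassoc_of% incl₃_br2] at h₃
  rw [reassoc_of% incl₃_br1] at h₁
  have hs : incl₃ i P ≫ tripleLeft k m P =
      V ◁ brL V V P ≫ brL V V (V ⊗ P) ≫ incl₃ i P ≫ tripleRight k m P := by
    rw [h.tripleLeft_eq, reassoc_of% incl₃_br2, reassoc_of% incl₃_br1]
  have h₂ : V ◁ brL V V P ≫ incl₃ i P ≫ tripleLeft k m P = -(incl₃ i P ≫ tripleLeft k m P) := by
    have := congrArg (fun t => V ◁ brL V V P ≫ t) h₁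
    simp only [Preadditive.comp_add, comp_zero, ← hs] at this
    exact eq_neg_of_add_eq_zero_right this
  have h₄ : incl₃ i P ≫ tripleLeft k m P = incl₃ i P ≫ tripleRight k m P := by
    rw [h₂, ← sub_eq_add_neg, sub_eq_zero] at h₃
    exact h₃.symm
  exact ⟨h₄, h₄ ▸ h₂⟩

theorem mulIncl_of_composition (h2 : TwoInvertible C) {d : 𝟙_ C ⟶ A ⊗ A} (hd : IsCopairing k d)
    (hw : ∀ P, (2 : ℤ) • opL w P = incl₂ i P ≫ (opL m P - brL A A P ≫ opL m P) ≫ q ▷ P) :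
    MulIncl m e i kV w := by
  intro P
  have hf := h.incl_mul_form_of_composition hc
  have hf' (P : C) : incl₂ i P ≫ brL A A P ≫ opL m P ≫ formL p P = -cupL kV P := by
    rw [reassoc_of% incl₂_br, hf, Preadditive.comp_neg, h.symmV]
  have h₁ : q ▷ P ≫ i ▷ P = 𝟙 _ - formL p P ≫ ptL e P := by
    rw [← h.decomposition P]; abel
  -- The commutator already lies in V, as xy and yx have the same e-component, so the projection q
  -- loses nothing.
  have hwi : (2 : ℤ) • (opL w P ≫ i ▷ P) =
      incl₂ i P ≫ opL m P - incl₂ i P ≫ brL A A P ≫ opL m P := by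
    rw [← Preadditive.zsmul_comp, hw, Category.assoc, Category.assoc, h₁]
    simp only [Preadditive.comp_sub, Preadditive.sub_comp, Category.comp_id, Category.assoc,
      reassoc_of% hf, reassoc_of% hf']
    abel
  -- The anticommutator is found by pairing it from the left: with e by the formula for p(xy), with
  -- V by antisymmetry of x·(yz). Half the sum with the commutator is the product.
  have hsum : incl₂ i P ≫ opL m P + incl₂ i P ≫ brL A A P ≫ opL m P =
      -((2 : ℤ) • (cupL kV P ≫ ptL e P)) := by
    apply hd.cancel_left
    apply h.ext_one
    · rw [← reassoc_of% ptL_natural, ← reassoc_of% ptL_natural, h.one_cup]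
      simp only [Preadditive.add_comp, Preadditive.neg_comp, Preadditive.zsmul_comp, Category.assoc,
        hf, hf', h.one_form, Category.comp_id]
      abel
    · rw [← whisker_exchange_assoc, ← whisker_exchange_assoc]
      have hT := (h.incl_triple_of_composition hc P).2
      have hR : incl₃ i P ≫ tripleRight k m P =
          V ◁ incl₂ i P ≫ V ◁ opL m P ≫ i ▷ (A ⊗ P) ≫ cupL k P := by
        rw [incl₃, tripleRight, Category.assoc, ← whisker_exchange_assoc]
      rw [hR] at hT
      simp only [reassoc_of% incl₂_br, MonoidalPreadditive.whiskerLeft_add, whiskerLeft_comp,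
        Preadditive.add_comp, Category.assoc, hT, whiskerLeft_neg', whiskerLeft_zsmul',
        Preadditive.neg_comp, Preadditive.zsmul_comp, h.incl_cup_one, comp_zero, smul_zero]
      abel
  apply (h2 _ _).1
  change (2 : ℤ) • _ = (2 : ℤ) • _
  rw [smul_sub, hwi, sub_eq_add_neg _ ((2 : ℤ) • _), ← hsum, two_smul]
  abel

theorem isAlternating_of_composition (hm : MulIncl m e i kV w)
    (ha : ∀ P, brL V V P ≫ opL w P = -opL w P) : IsAlternating kV w where
  symm := h.symmV
  asymm := ha
  assoc P := by
    rw [← h.incl_tripleRight hm, ← h.incl_tripleLeft hm, (h.incl_triple_of_composition hc P).1]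

theorem isVectorProductAlgebra_of_composition {d : 𝟙_ C ⟶ A ⊗ A} (hd : IsCopairing k d)
    (hm : MulIncl m e i kV w) (ha : ∀ P, brL V V P ≫ opL w P = -opL w P) :
    IsVectorProductAlgebra kV w := by
  have halt := h.isAlternating_of_composition hc hm ha
  refine .of_quadIdentity (h.isCopairing_proj hd).isDualityCounit halt
    (halt.quadIdentity_iff.2 fun P => ?_)
  rw [← h.incl_compSum hm, hc, Preadditive.comp_zsmul, h.incl_cupPair]

end IsSplitUnital

end Complement

/-! ### Passing between plain morphisms and strands -/

section Raw

variable {C : Type u} [Category.{v} C] [MonoidalCategory C]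

theorem opL_injective {X Y Z : C} {f g : X ⊗ Y ⟶ Z} (h : ∀ P, opL f P = opL g P) : f = g := by
  have := h (𝟙_ C)
  rwa [opL, opL, cancel_epi, whiskerRight_iff] at this

theorem incl₂_opL {A V Z : C} (i : V ⟶ A) (m : A ⊗ A ⟶ Z) (P : C) :
    incl₂ i P ≫ opL m P = opL ((i ⊗ₘ i) ≫ m) P := by
  simp [incl₂, opL, MonoidalCategory.tensorHom_def']

theorem incl₂_cupL {A V : C} (i : V ⟶ A) (k : A ⊗ A ⟶ 𝟙_ C) (P : C) :
    incl₂ i P ≫ cupL k P = cupL ((i ⊗ₘ i) ≫ k) P := by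
  simp [incl₂, cupL, MonoidalCategory.tensorHom_def']

theorem opL_comp {X Y Z W : C} (m : X ⊗ Y ⟶ Z) (f : Z ⟶ W) (P : C) :
    opL (m ≫ f) P = opL m P ≫ f ▷ P := by
  simp [opL]

theorem opL_cup_comp {X Y Z : C} (k : X ⊗ Y ⟶ 𝟙_ C) (e : 𝟙_ C ⟶ Z) (P : C) :
    opL (k ≫ e) P = cupL k P ≫ ptL e P := by
  simp [opL, cupL, ptL]

variable [Preadditive C] [MonoidalPreadditive C]

theorem opL_sub {X Y Z : C} (f g : X ⊗ Y ⟶ Z) (P : C) : opL (f - g) P = opL f P - opL g P := by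
  simp [opL, sub_whiskerRight']

theorem opL_zsmul {X Y Z : C} (n : ℤ) (f : X ⊗ Y ⟶ Z) (P : C) : opL (n • f) P = n • opL f P := by
  simp [opL, zsmul_whiskerRight']

theorem mulIncl_iff {A V : C} {m : A ⊗ A ⟶ A} {e : 𝟙_ C ⟶ A} {i : V ⟶ A} {kV : V ⊗ V ⟶ 𝟙_ C}
    {w : V ⊗ V ⟶ V} : MulIncl m e i kV w ↔ (i ⊗ₘ i) ≫ m = w ≫ i - kV ≫ e := by
  simp only [MulIncl, incl₂_opL, ← opL_comp, ← opL_cup_comp, ← opL_sub]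
  exact ⟨opL_injective, fun h P => by rw [h]⟩

variable [BraidedCategory C]

omit [Preadditive C] [MonoidalPreadditive C] in
theorem brL_opL {X Y Z : C} (m : Y ⊗ X ⟶ Z) (P : C) :
    brL X Y P ≫ opL m P = opL ((β_ X Y).hom ≫ m) P := by
  simp [opL, brL]

omit [Preadditive C] [MonoidalPreadditive C] in
theorem IsUnital.of_raw {A : C} {k : A ⊗ A ⟶ 𝟙_ C} {m : A ⊗ A ⟶ A} {e : 𝟙_ C ⟶ A} {p : A ⟶ 𝟙_ C}
    (symm : (β_ A A).hom ≫ k = k) (one_mul : e ▷ A ≫ m = (λ_ A).hom)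
    (mul_one : A ◁ e ≫ m = (ρ_ A).hom) (cup_one : (ρ_ A).inv ≫ A ◁ e ≫ k = p)
    (one_form : e ≫ p = 𝟙 _) : IsUnital k m e p where
  symm := (brL_cupL_iff k).1 symm
  one_mul P := by
    have := congrArg (fun t => (λ_ (A ⊗ P)).inv ≫ (α_ (𝟙_ C) A P).inv ≫ t ▷ P) one_mul
    simpa [ptL, opL] using this
  mul_one P := by
    have := congrArg (fun t => A ◁ (λ_ P).inv ≫ (α_ A (𝟙_ C) P).inv ≫ t ▷ P) mul_one
    simpa [ptL, opL] using this
  cup_one P := by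
    subst cup_one
    simp [ptL, cupL, formL]
  one_form P := by
    simp [ptL, formL, ← comp_whiskerRight_assoc, one_form]

end Raw

/-! ### The complement of the unit is a vector product algebra -/

section ToVPA

variable {C : Type u} [Category.{v} C] [MonoidalCategory C] [BraidedCategory C] [Preadditive C]

theorem CA.nonempty_unitComplement [IsIdempotentComplete C] (A : CA C) :
    Nonempty A.UnitComplement := by
  have h : (𝟙 A.X - A.p ≫ A.one) ≫ (𝟙 A.X - A.p ≫ A.one) = 𝟙 A.X - A.p ≫ A.one := by
    have := A.one_p
    simp [reassoc_of% this]
  obtain ⟨V, i, q, h₁, h₂⟩ := IsIdempotentComplete.idempotents_split A.X _ h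
  exact ⟨⟨V, i, q, h₁, h₂⟩⟩

variable {A : CA C}

theorem CA.isUnital (A : CA C) : IsUnital A.cup A.mul A.one A.p :=
  .of_raw A.isCA.selfDual.symm A.isCA.one_mul A.isCA.mul_one rfl A.one_p

theorem CA.UnitComplement.isSplitUnital (S : A.UnitComplement) :
    IsSplitUnital A.cup A.mul A.one A.p S.i S.q S.cup where
  toIsUnital := A.isUnital
  e_p := A.one_p
  e_q := S.one_q
  i_p := S.i_p
  i_q := S.i_q
  total := by rw [S.q_i]; abel
  cup_incl := incl₂_cupL _ _

variable [MonoidalPreadditive C] (h2 : TwoInvertible C)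

theorem CA.compSum_eq (A : CA C) (P : C) :
    compSum A.cup A.mul P = (2 : ℤ) • cupPair A.cup P :=
  (composition_iff A.cup A.mul).1 A.isCA.composition P

omit [MonoidalPreadditive C] in
theorem CA.UnitComplement.two_wedge (S : A.UnitComplement) : (2 : ℤ) • S.wedge h2 =
    (S.i ⊗ₘ S.i) ≫ (A.mul - (β_ A.X A.X).hom ≫ A.mul) ≫ S.q := by
  rw [wedge, CA.wedge, ← Preadditive.comp_zsmul, ← Preadditive.zsmul_comp, two_half]

-- The axiom m c c = m enters here: braiding the commutator m − m c gives m c − m c c, its negative.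
omit [MonoidalPreadditive C] in
theorem CA.UnitComplement.wedge_asymm (S : A.UnitComplement) :
    S.wedge h2 = -((β_ S.V S.V).hom ≫ S.wedge h2) := by
  apply (h2 _ _).1
  change (2 : ℤ) • _ = (2 : ℤ) • _
  rw [smul_neg, ← Preadditive.comp_zsmul, S.two_wedge,
    ← BraidedCategory.braiding_naturality_assoc]
  have := A.isCA.braid_braid_mul
  simp only [Preadditive.sub_comp, Preadditive.comp_sub, Category.assoc, reassoc_of% this]
  abel

theorem CA.UnitComplement.mulIncl (S : A.UnitComplement) :
    MulIncl A.mul A.one S.i S.cup (S.wedge h2) := by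
  obtain ⟨d, hd⟩ := A.isCA.selfDual.counit.exists_copairing
  refine S.isSplitUnital.mulIncl_of_composition A.compSum_eq h2 hd fun P => ?_
  rw [← opL_zsmul, S.two_wedge, ← Category.assoc, opL_comp, ← incl₂_opL, opL_sub, brL_opL,
    Category.assoc]

theorem CA.UnitComplement.isVectorProductAlgebra (S : A.UnitComplement) :
    IsVectorProductAlgebra S.cup (S.wedge h2) := by
  obtain ⟨d, hd⟩ := A.isCA.selfDual.counit.exists_copairing
  exact S.isSplitUnital.isVectorProductAlgebra_of_composition A.compSum_eq hd (S.mulIncl h2)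
    ((brL_opL_iff _).1 (S.wedge_asymm h2))

theorem CA.UnitComplement.tensorHom_eq (S : A.UnitComplement) {Z : C} (f : A.X ⊗ A.X ⟶ Z) :
    f = (A.p ⊗ₘ A.p) ≫ (A.one ⊗ₘ A.one) ≫ f + (A.p ⊗ₘ S.q) ≫ (A.one ⊗ₘ S.i) ≫ f +
      (S.q ⊗ₘ A.p) ≫ (S.i ⊗ₘ A.one) ≫ f + (S.q ⊗ₘ S.q) ≫ (S.i ⊗ₘ S.i) ≫ f := by
  conv_lhs => rw [← Category.id_comp f, ← id_tensorHom_id, ← S.isSplitUnital.total]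
  simp only [tensorHom_comp_tensorHom_assoc, MonoidalPreadditive.tensor_add,
    MonoidalPreadditive.add_tensor, Preadditive.add_comp]
  abel

/-- Of the four blocks of A ⊗ A, the two mixed ones vanish by orthogonality. -/
theorem CA.UnitComplement.cup_eq (S : A.UnitComplement) :
    A.cup = (S.q ⊗ₘ S.q) ≫ S.cup + (A.p ⊗ₘ A.p) ≫ (λ_ (𝟙_ C)).hom := by
  have h₁ : (A.one ⊗ₘ A.one) ≫ A.cup = (λ_ (𝟙_ C)).hom := by
    rw [← cancel_epi (λ_ (𝟙_ C)).inv, A.isCA.one_cup_one, Iso.inv_hom_id]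
  have h₂ : (S.i ⊗ₘ A.one) ≫ A.cup = 0 := by
    have : A.X ◁ A.one ≫ A.cup = (ρ_ A.X).hom ≫ A.p := by rw [CA.p, Iso.hom_inv_id_assoc]
    rw [MonoidalCategory.tensorHom_def, Category.assoc, this, rightUnitor_naturality_assoc, S.i_p,
      comp_zero]
  have h₃ : (A.one ⊗ₘ S.i) ≫ A.cup = 0 := by
    rw [← A.isCA.selfDual.symm, BraidedCategory.braiding_naturality_assoc, h₂, comp_zero]
  conv_lhs => rw [S.tensorHom_eq A.cup, h₁, h₂, h₃]
  rw [cup]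
  simp only [comp_zero]
  abel

/-- Three blocks are fixed by the unit laws and the fourth by xy = x ∧ y − (x·y)e, so A has exactly
the multiplication prescribed on I ⊕ V. -/
theorem CA.UnitComplement.mul_eq (S : A.UnitComplement) :
    A.mul = ((A.p ⊗ₘ A.p) ≫ (λ_ (𝟙_ C)).hom - (S.q ⊗ₘ S.q) ≫ S.cup) ≫ A.one
      + ((A.p ⊗ₘ S.q) ≫ (λ_ S.V).hom + (S.q ⊗ₘ A.p) ≫ (ρ_ S.V).hom
        + (S.q ⊗ₘ S.q) ≫ S.wedge h2) ≫ S.i := by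
  have h₁ : (A.one ⊗ₘ A.one) ≫ A.mul = (λ_ (𝟙_ C)).hom ≫ A.one := by
    rw [MonoidalCategory.tensorHom_def', Category.assoc, A.isCA.one_mul, leftUnitor_naturality]
  have h₂ : (S.i ⊗ₘ A.one) ≫ A.mul = (ρ_ S.V).hom ≫ S.i := by
    rw [MonoidalCategory.tensorHom_def, Category.assoc, A.isCA.mul_one, rightUnitor_naturality]
  have h₃ : (A.one ⊗ₘ S.i) ≫ A.mul = (λ_ S.V).hom ≫ S.i := by
    rw [MonoidalCategory.tensorHom_def', Category.assoc, A.isCA.one_mul, leftUnitor_naturality]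
  conv_lhs => rw [S.tensorHom_eq A.mul, h₁, h₂, h₃, mulIncl_iff.1 (S.mulIncl h2)]
  simp only [Preadditive.sub_comp, Preadditive.comp_sub, Preadditive.add_comp, Category.assoc]
  abel

end ToVPA

/-! ### I ⊕ V is a composition algebra -/

section ToCA

variable {C : Type u} [Category.{v} C] [MonoidalCategory C] [BraidedCategory C] [Preadditive C]
  [HasFiniteBiproducts C] (V : VPA C)

theorem VPA.isUnitSum : IsUnitSum V.e V.p V.i V.q where
  e_p := biprod.inl_fst
  e_q := biprod.inl_snd
  i_p := biprod.inr_fst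
  i_q := biprod.inr_snd
  total := biprod.total

theorem VPA.sumCup_symm : (β_ V.sumObj V.sumObj).hom ≫ V.sumCup = V.sumCup := by
  have := V.isVPA.selfDual.symm
  rw [sumCup, Preadditive.comp_add, ← BraidedCategory.braiding_naturality_assoc,
    ← BraidedCategory.braiding_naturality_assoc, this, braiding_leftUnitor, unitors_equal]

variable [MonoidalPreadditive C]

theorem VPA.cup_e : (ρ_ V.sumObj).inv ≫ V.sumObj ◁ V.e ≫ V.sumCup = V.p := by
  have h := V.isUnitSum
  rw [sumCup, ← id_tensorHom, Preadditive.comp_add, tensorHom_comp_tensorHom_assoc,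
    tensorHom_comp_tensorHom_assoc, h.e_p, h.e_q]
  simp [unitors_equal]

theorem VPA.e_mul : V.e ▷ V.sumObj ≫ V.sumMul = (λ_ V.sumObj).hom := by
  have h := V.isUnitSum
  rw [sumMul, ← tensorHom_id]
  simp only [Preadditive.comp_add, Preadditive.comp_sub, Preadditive.add_comp, Preadditive.sub_comp,
    Category.assoc, tensorHom_comp_tensorHom_assoc, h.e_p, h.e_q, Category.id_comp,
    MonoidalPreadditive.zero_tensor, zero_comp, sub_zero, add_zero, id_tensorHom,
    leftUnitor_naturality_assoc]
  rw [← Preadditive.comp_add, h.total, Category.comp_id]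

theorem VPA.mul_e : V.sumObj ◁ V.e ≫ V.sumMul = (ρ_ V.sumObj).hom := by
  have h := V.isUnitSum
  rw [sumMul, ← id_tensorHom, unitors_equal]
  simp only [Preadditive.comp_add, Preadditive.comp_sub, Preadditive.add_comp, Preadditive.sub_comp,
    Category.assoc, tensorHom_comp_tensorHom_assoc, h.e_p, h.e_q, Category.id_comp,
    MonoidalPreadditive.tensor_zero, zero_comp, sub_zero, add_zero, zero_add, tensorHom_id,
    rightUnitor_naturality_assoc]
  rw [← Preadditive.comp_add, h.total, Category.comp_id]

theorem VPA.isSplitUnital : IsSplitUnital V.sumCup V.sumMul V.e V.p V.i V.q V.cup where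
  toIsUnital := .of_raw V.sumCup_symm V.e_mul V.mul_e V.cup_e V.isUnitSum.e_p
  toIsUnitSum := V.isUnitSum
  cup_incl P := by
    have h := V.isUnitSum
    rw [incl₂_cupL, sumCup, Preadditive.comp_add, tensorHom_comp_tensorHom_assoc,
      tensorHom_comp_tensorHom_assoc, h.i_p, h.i_q]
    simp

theorem VPA.mulIncl : MulIncl V.sumMul V.e V.i V.cup V.wedge := by
  have h := V.isUnitSum
  rw [mulIncl_iff, sumMul]
  simp only [Preadditive.comp_add, Preadditive.comp_sub, Preadditive.add_comp, Preadditive.sub_comp,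
    Category.assoc, tensorHom_comp_tensorHom_assoc, h.i_p, h.i_q, MonoidalPreadditive.tensor_zero,
    MonoidalPreadditive.zero_tensor, zero_comp, id_tensorHom_id, Category.id_comp]
  abel

theorem VPA.isCompositionAlgebra : IsCompositionAlgebra V.sumCup V.sumMul V.e where
  selfDual := by
    obtain ⟨d, hd⟩ := V.isVPA.selfDual.counit.exists_copairing
    exact ⟨(V.isSplitUnital.isCopairing_incl hd).isDualityCounit, V.sumCup_symm⟩
  one_cup_one := by
    have h := V.isUnitSum
    rw [sumCup, Preadditive.comp_add, tensorHom_comp_tensorHom_assoc,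
      tensorHom_comp_tensorHom_assoc, h.e_p, h.e_q]
    simp
  braid_braid_mul := opL_injective fun P => by
    rw [← brL_opL, ← brL_opL, V.isSplitUnital.braid_braid_mul V.mulIncl V.isVPA.isAlternating]
  one_mul := V.e_mul
  mul_one := V.mul_e
  composition := (composition_iff _ _).2
    (V.isSplitUnital.composition_of_quadIdentity V.mulIncl V.isVPA.isAlternating
      V.isVPA.quadIdentity)

end ToCA

/-! ### The comparison isomorphisms and the equivalence -/

section Equivalence

variable {C : Type u} [Category.{v} C] [MonoidalCategory C] [BraidedCategory C] [Preadditive C]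

theorem CA.isIso_of_isIso_hom {A B : CA C} (f : A ⟶ B) [IsIso (CA.Hom.hom f)] : IsIso f := by
  have hf : (inv (CA.Hom.hom f) ⊗ₘ inv (CA.Hom.hom f)) ≫ (CA.Hom.hom f ⊗ₘ CA.Hom.hom f) = 𝟙 _ := by
    rw [tensorHom_comp_tensorHom, IsIso.inv_hom_id, id_tensorHom_id]
  let g : B ⟶ A :=
    { hom := inv (CA.Hom.hom f)
      map_cup := by rw [← CA.Hom.map_cup f, reassoc_of% hf]
      map_mul := by
        rw [IsIso.eq_comp_inv, Category.assoc, ← CA.Hom.map_mul f, reassoc_of% hf]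
      map_one := by rw [IsIso.comp_inv_eq, CA.Hom.map_one f] }
  exact ⟨g, CA.Hom.ext (IsIso.hom_inv_id (CA.Hom.hom f)), CA.Hom.ext (IsIso.inv_hom_id (CA.Hom.hom f))⟩

theorem VPA.isIso_of_isIso_hom {V W : VPA C} (f : V ⟶ W) [IsIso (VPA.Hom.hom f)] : IsIso f := by
  have hf : (inv (VPA.Hom.hom f) ⊗ₘ inv (VPA.Hom.hom f)) ≫ (VPA.Hom.hom f ⊗ₘ VPA.Hom.hom f) =
      𝟙 _ := by
    rw [tensorHom_comp_tensorHom, IsIso.inv_hom_id, id_tensorHom_id]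
  let g : W ⟶ V :=
    { hom := inv (VPA.Hom.hom f)
      map_cup := by rw [← VPA.Hom.map_cup f, reassoc_of% hf]
      map_wedge := by
        rw [IsIso.eq_comp_inv, Category.assoc, ← VPA.Hom.map_wedge f, reassoc_of% hf] }
  exact ⟨g, VPA.Hom.ext (IsIso.hom_inv_id (VPA.Hom.hom f)),
    VPA.Hom.ext (IsIso.inv_hom_id (VPA.Hom.hom f))⟩

section Complement

variable {A : CA C} {V : VPA C} {i : V.X ⟶ A.X} {q : A.X ⟶ V.X} (h : IsUnitSum A.one A.p i q)
  (T : A.UnitComplement)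

include h in
theorem CA.UnitComplement.q_i_proj : T.q ≫ T.i ≫ q = q := by
  rw [← Category.assoc, T.q_i, Preadditive.sub_comp, Category.assoc, h.e_q]
  simp

-- T.V and V split the same idempotent 1 − ep, so inclusion followed by projection identifies them.
include h in
theorem CA.UnitComplement.isIso_i_proj : IsIso (T.i ≫ q) := by
  refine ⟨i ≫ T.q, ?_, ?_⟩
  · have h₁ : q ≫ i = 𝟙 _ - A.p ≫ A.one := by rw [← h.total]; abel
    rw [Category.assoc, reassoc_of% h₁, Preadditive.sub_comp, Category.assoc, T.one_q]
    simp [T.i_q]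
  · rw [Category.assoc, T.q_i_proj h, h.i_q]

theorem CA.UnitComplement.i_proj_naturality {B : CA C} {W : VPA C} {r : B.X ⟶ W.X}
    (T' : B.UnitComplement) (f : CA.Hom A B) (g : VPA.Hom V W) (hf : f.hom ≫ r = q ≫ g.hom) :
    (T.i ≫ f.hom ≫ T'.q) ≫ T'.i ≫ r = (T.i ≫ q) ≫ g.hom := by
  rw [← Category.assoc _ T'.i, f.restrict T T', Category.assoc, hf, Category.assoc]

variable [MonoidalPreadditive C]

theorem CA.UnitComplement.i_proj_cup
    (hcup : A.cup = (q ⊗ₘ q) ≫ V.cup + (A.p ⊗ₘ A.p) ≫ (λ_ (𝟙_ C)).hom) :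
    (T.i ≫ q ⊗ₘ T.i ≫ q) ≫ V.cup = T.cup := by
  rw [CA.UnitComplement.cup, hcup, Preadditive.comp_add, tensorHom_comp_tensorHom_assoc,
    tensorHom_comp_tensorHom_assoc, T.i_p]
  simp

-- On the complement the p-terms of the product vanish, leaving V's wedge; anticommutativity doubles
-- it in the commutator, and the half removes the 2.
include h in
theorem CA.UnitComplement.i_proj_wedge (h2 : TwoInvertible C)
    (hmul : A.mul ≫ q = (A.p ⊗ₘ q) ≫ (λ_ V.X).hom + (q ⊗ₘ A.p) ≫ (ρ_ V.X).hom +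
      (q ⊗ₘ q) ≫ V.wedge) :
    (T.i ≫ q ⊗ₘ T.i ≫ q) ≫ V.wedge = T.wedge h2 ≫ T.i ≫ q := by
  have h₁ : (T.i ⊗ₘ T.i) ≫ A.mul ≫ q = (T.i ≫ q ⊗ₘ T.i ≫ q) ≫ V.wedge := by
    rw [hmul]
    simp only [Preadditive.comp_add, tensorHom_comp_tensorHom_assoc, T.i_p,
      MonoidalPreadditive.tensor_zero, MonoidalPreadditive.zero_tensor, zero_comp, zero_add]
  have h₂ : (T.i ⊗ₘ T.i) ≫ (β_ A.X A.X).hom ≫ A.mul ≫ q =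
      -((T.i ≫ q ⊗ₘ T.i ≫ q) ≫ V.wedge) := by
    rw [BraidedCategory.braiding_naturality_assoc, h₁, ← BraidedCategory.braiding_naturality_assoc,
      ← neg_eq_iff_eq_neg.2 V.isVPA.asymm, Preadditive.comp_neg]
  apply (h2 _ _).1
  change (2 : ℤ) • _ = (2 : ℤ) • _
  rw [← Preadditive.zsmul_comp (f := T.wedge h2), T.two_wedge, Category.assoc, Category.assoc,
    T.q_i_proj h, Preadditive.sub_comp, Preadditive.comp_sub, Category.assoc, h₁, h₂, two_smul,
    sub_neg_eq_add]

end Complement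

variable [HasFiniteBiproducts C]

theorem VPA.sum_hom_ext {X : C} {V : VPA C} {f g : X ⟶ V.sumObj} (hp : f ≫ V.p = g ≫ V.p)
    (hq : f ≫ V.q = g ≫ V.q) : f = g := biprod.hom_ext _ _ hp hq

section Comparison

variable {A : CA C} {V : VPA C} {i : V.X ⟶ A.X} {q : A.X ⟶ V.X} (h : IsUnitSum A.one A.p i q)

/-- The comparison of a composition algebra with a direct sum `I ⊕ V`. -/
noncomputable def toSum (A : CA C) {V : VPA C} (q : A.X ⟶ V.X) : A.X ⟶ V.sumObj :=
  biprod.lift A.p q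

theorem toSum_p (q : A.X ⟶ V.X) : toSum A q ≫ V.p = A.p := biprod.lift_fst _ _

theorem toSum_q (q : A.X ⟶ V.X) : toSum A q ≫ V.q = q := biprod.lift_snd _ _

theorem toSum_naturality {B : CA C} {W : VPA C} {q : A.X ⟶ V.X} {r : B.X ⟶ W.X} (f : CA.Hom A B)
    (g : VPA.Hom V W) (hf : f.hom ≫ r = q ≫ g.hom) : f.hom ≫ toSum B r = toSum A q ≫ g.sumMap := by
  apply VPA.sum_hom_ext
  · rw [Category.assoc, toSum_p, f.hom_p, Category.assoc, g.sumMap_p, toSum_p]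
  · rw [Category.assoc, toSum_q, Category.assoc, g.sumMap_q, reassoc_of% toSum_q q, hf]

include h

theorem one_toSum : A.one ≫ toSum A q = V.e := by
  apply VPA.sum_hom_ext
  · rw [Category.assoc, toSum_p, A.one_p, V.isUnitSum.e_p]
  · rw [Category.assoc, toSum_q, h.e_q, V.isUnitSum.e_q]

theorem incl_toSum : i ≫ toSum A q = V.i := by
  apply VPA.sum_hom_ext
  · rw [Category.assoc, toSum_p, h.i_p, V.isUnitSum.i_p]
  · rw [Category.assoc, toSum_q, h.i_q, V.isUnitSum.i_q]

theorem isIso_toSum : IsIso (toSum A q) := by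
  refine ⟨V.p ≫ A.one + V.q ≫ i, ?_, ?_⟩
  · rw [Preadditive.comp_add, reassoc_of% toSum_p q, reassoc_of% toSum_q q, h.total]
  · rw [Preadditive.add_comp, Category.assoc, Category.assoc, one_toSum h, incl_toSum h,
      V.isUnitSum.total]

/-- The comparison as a morphism of composition algebras. -/
noncomputable def toSumHom (hA : ∀ V : VPA C, IsCompositionAlgebra V.sumCup V.sumMul V.e)
    (hcup : A.cup = (q ⊗ₘ q) ≫ V.cup + (A.p ⊗ₘ A.p) ≫ (λ_ (𝟙_ C)).hom)
    (hmul : A.mul = ((A.p ⊗ₘ A.p) ≫ (λ_ (𝟙_ C)).hom - (q ⊗ₘ q) ≫ V.cup) ≫ A.one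
      + ((A.p ⊗ₘ q) ≫ (λ_ V.X).hom + (q ⊗ₘ A.p) ≫ (ρ_ V.X).hom + (q ⊗ₘ q) ≫ V.wedge) ≫ i) :
    A ⟶ (toCA hA).obj V where
  hom := toSum A q
  map_cup := by
    change (toSum A q ⊗ₘ toSum A q) ≫ V.sumCup = A.cup
    rw [VPA.sumCup, Preadditive.comp_add, tensorHom_comp_tensorHom_assoc,
      tensorHom_comp_tensorHom_assoc, toSum_p, toSum_q, hcup]
  map_mul := by
    change (toSum A q ⊗ₘ toSum A q) ≫ V.sumMul = A.mul ≫ toSum A q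
    rw [hmul, VPA.sumMul]
    simp only [Preadditive.add_comp, Preadditive.sub_comp, Preadditive.comp_add,
      Preadditive.comp_sub, Category.assoc, tensorHom_comp_tensorHom_assoc, toSum_p, toSum_q,
      one_toSum h, incl_toSum h]
  map_one := one_toSum h

end Comparison

variable [MonoidalPreadditive C] (h2 : TwoInvertible C)

variable (hA : ∀ V : VPA C, IsCompositionAlgebra V.sumCup V.sumMul V.e)
  (S : ∀ A : CA C, A.UnitComplement)
  (hS : ∀ A : CA C, IsVectorProductAlgebra (S A).cup ((S A).wedge h2))

/-- The comparison of a composition algebra with the direct sum of its unit and the complement. -/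
noncomputable def complementSumHom (A : CA C) : A ⟶ (toVPA h2 S hS ⋙ toCA hA).obj A :=
  toSumHom (V := (toVPA h2 S hS).obj A) (S A).isSplitUnital.toIsUnitSum hA (S A).cup_eq
    ((S A).mul_eq h2)

theorem isIso_complementSumHom (A : CA C) : IsIso (complementSumHom h2 hA S hS A) :=
  haveI : IsIso (CA.Hom.hom (complementSumHom h2 hA S hS A)) :=
    isIso_toSum (V := (toVPA h2 S hS).obj A) (S A).isSplitUnital.toIsUnitSum
  CA.isIso_of_isIso_hom _

/-- A composition algebra is the direct sum of its unit and the complement, naturally. -/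
noncomputable def toVPACompToCAIso : toVPA h2 S hS ⋙ toCA hA ≅ 𝟭 (CA C) :=
  (NatIso.ofComponents (F := 𝟭 (CA C)) (G := toVPA h2 S hS ⋙ toCA hA)
    (fun A => @asIso _ _ _ _ (complementSumHom h2 hA S hS A)
      (isIso_complementSumHom h2 hA S hS A))
    (fun {A B} f => CA.Hom.ext <|
      toSum_naturality (V := (toVPA h2 S hS).obj A) (W := (toVPA h2 S hS).obj B) f
        ((toVPA h2 S hS).map f) (CA.UnitComplement.q_i_hom_q f (S A) (S B)).symm)).symm

theorem toCA_p (V : VPA C) : ((toCA hA).obj V).p = V.p := V.cup_e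

theorem isUnitSum_toCA (V : VPA C) :
    IsUnitSum ((toCA hA).obj V).one ((toCA hA).obj V).p V.i V.q := by
  rw [toCA_p]
  exact V.isUnitSum

variable (V : VPA C)

/-- The comparison of the complement of the unit in `I ⊕ V` with `V`. -/
noncomputable def complementHom : (toCA hA ⋙ toVPA h2 S hS).obj V ⟶ V where
  hom := (S ((toCA hA).obj V)).i ≫ V.q
  map_cup := (S ((toCA hA).obj V)).i_proj_cup (by rw [toCA_p]; rfl)
  map_wedge := (S ((toCA hA).obj V)).i_proj_wedge (isUnitSum_toCA hA V) h2 (by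
    rw [toCA_p]
    change V.sumMul ≫ V.q = _
    rw [VPA.sumMul, Preadditive.add_comp, Category.assoc, Category.assoc, V.isUnitSum.e_q,
      V.isUnitSum.i_q, comp_zero, zero_add, Category.comp_id]
    rfl)

theorem isIso_complementHom : IsIso (complementHom h2 hA S hS V) :=
  haveI : IsIso (VPA.Hom.hom (complementHom h2 hA S hS V)) :=
    (S ((toCA hA).obj V)).isIso_i_proj (isUnitSum_toCA hA V)
  VPA.isIso_of_isIso_hom _

/-- The complement of the unit in `I ⊕ V` is `V`, naturally. -/
noncomputable def toCACompToVPAIso : toCA hA ⋙ toVPA h2 S hS ≅ 𝟭 (VPA C) :=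
  NatIso.ofComponents
    (fun V => @asIso _ _ _ _ (complementHom h2 hA S hS V) (isIso_complementHom h2 hA S hS V))
    (fun {V W} g => VPA.Hom.ext <|
      (S ((toCA hA).obj V)).i_proj_naturality (S ((toCA hA).obj W)) ((toCA hA).map g) g
        (VPA.Hom.sumMap_q g))

end Equivalence

end BraidedAlg

theorem mainTheorem5 {C : Type u} [Category.{v} C] [MonoidalCategory C] [BraidedCategory C]
    [Preadditive C] [MonoidalPreadditive C] [HasFiniteBiproducts C] [IsIdempotentComplete C]
    (h2 : BraidedAlg.TwoInvertible C) :
    (∀ A : BraidedAlg.CA C, Nonempty A.UnitComplement) ∧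
    ∃ hA : ∀ V : BraidedAlg.VPA C,
        BraidedAlg.IsCompositionAlgebra V.sumCup V.sumMul V.e,
      ∀ S : ∀ A : BraidedAlg.CA C, A.UnitComplement,
        ∃ hS : ∀ A : BraidedAlg.CA C,
            BraidedAlg.IsVectorProductAlgebra (S A).cup ((S A).wedge h2),
          (BraidedAlg.toVPA h2 S hS).IsEquivalence ∧
          Nonempty (BraidedAlg.toVPA h2 S hS ⋙ BraidedAlg.toCA hA ≅ 𝟭 (BraidedAlg.CA C)) ∧
          Nonempty (BraidedAlg.toCA hA ⋙ BraidedAlg.toVPA h2 S hS ≅ 𝟭 (BraidedAlg.VPA C)) := by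
  have hA (V : BraidedAlg.VPA C) := V.isCompositionAlgebra
  refine ⟨fun A => A.nonempty_unitComplement, hA, fun S => ?_⟩
  have hS (A : BraidedAlg.CA C) := (S A).isVectorProductAlgebra h2
  let η := BraidedAlg.toVPACompToCAIso h2 hA S hS
  let ε := BraidedAlg.toCACompToVPAIso h2 hA S hS
  exact ⟨hS, (CategoryTheory.Equivalence.mk _ _ η.symm ε).isEquivalence_functor, ⟨η⟩, ⟨ε⟩⟩
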